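/- **Setting.** Let $G$ be a finite connected multigraph (loops and parallel edges allowed) with vertex set $V$, edge set $E$ and an arbitrary orientation of the edges, $e$ running from $e^-$ to $e^+$. Let $H_1=H_1(G,\mathbb Z)\subset C_1=C_1(G,\mathbb Z)$ be the kernel of $e\mapsto e^+-e^-$, let $g$ be its rank, $N=\mathrm{Hom}(H_1,\mathbb Z)$, and $N_A=\mathrm{Hom}(H_1,A)$ for a commutative ring $A$. Given elements $x_e\in A$ $(e\in E)$, let $[\cdot,\cdot]\colon C_1\times C_1\to A$ be the bilinear pairing with $[e,e]=x_e$ and $[e,e']=0$ for $e\neq e'$, let $\pi\colon C_1\to N_A$, $\pi(c)=[c,\cdot]|_{H_1}$, and $\Lambda=\pi(H_1)$. Let $n_e\in N$ be the functional sending $\gamma$ to the multiplicity of $e$ in $\gamma$, so that $\pi(e)=x_en_e$. **Universal Ceresa period.** Take $A=R=\mathbb Z[x_e : e\in E]$. Let $C_q$ be the free abelian group on the ordered simplices $(u_0,\dots,u_q)\in N_R^{q+1}$ modulo simultaneous translation of all vertices by an element of $\Lambda$, with the usual boundary; put $C_{1,q}=N\otimes_{\mathbb Z}C_q$ with $\partial(n\otimes\sigma)=n\otimes\partial\sigma$,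 and let $[-1]_*$ send $n\otimes(u_0,\dots,u_q)$ to $(-n)\otimes(-u_0,\dots,-u_q)$. For a vertex $v$ let $\delta_e$ be a path from $v$ to $e^-$ and $$\Phi_v=\sum_{e\in E}n_e\otimes(\pi(\delta_e),\pi(\delta_e+e)),\qquad \mathrm{Cer}_v(G)=\Phi_v-[-1]_*\Phi_v .$$ Let $\Theta\colon C_{1,2}\to\bigwedge^3_RN_R$, $\Theta(n\otimes(u_0,u_1,u_2))=n\wedge(u_1-u_0)\wedge(u_2-u_0)$, and let $\mathscr P$ be the image under $\Theta$ of the $(1,2)$-cycles. Then $\alpha(G)$ is the class of $\Theta(\Sigma)$ in $\bigwedge^3_RN_R/\mathscr P$ for any $\Sigma\in C_{1,2}$ with $\partial\Sigma=\mathrm{Cer}_v(G)$; it depends neither on $\Sigma$ nor on $v$. **Ceresa period of a tropical curve.** A length function $\ell\in\mathbb R_{>0}^E$ defines a tropical curve $C$ with model $(G,\ell)$ (an edge $e$ becomes a segment of length $\ell(e)$). Take $A=\mathbb R$, $x_e=\ell(e)$, so $\Lambda_C=\pi(H_1)$ is a lattice in $N_{\mathbb R}$ and $\mathrm{Jac}(C)=N_{\mathbb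 R}/\Lambda_C$. Let $S_{1,q}=N\otimes_{\mathbb Z}S_q(\mathrm{Jac}(C))$ with $S_\bullet$ the smooth singular chains. For a base point $v\in C$ let $\mathrm{Cer}_v(C)\in S_{1,1}$ be given by the formula above, with affine simplices and with paths in $C$ (paths that start inside an edge having real coefficients). With $\epsilon_1,\dots,\epsilon_g$ a basis of $N$ and $z_1,\dots,z_g$ the corresponding coordinates on $N_{\mathbb R}$, let $\Theta_C\colon S_{1,2}\to\bigwedge^3N_{\mathbb R}$, $$\Theta_C\Big(\sum_i n_i\epsilon_i\otimes\sigma\Big)=2\sum_{i<j<k}\int_\sigma\big(n_i\,dz_j\wedge dz_k-n_j\,dz_i\wedge dz_k+n_k\,dz_i\wedge dz_j\big)\;\epsilon_i\wedge\epsilon_j\wedge\epsilon_k ,$$ and let $\mathscr P_C$ be the image under $\Theta_C$ of the $(1,2)$-cycles. Then $\alpha(C)$ is the class of $\Theta_C(\Sigma)$ in $\bigwedge^3N_{\mathbb R}/\mathscr P_C$ for any $\Sigma\in S_{1,2}$ with $\partial\Sigma=\mathrm{Cer}_v(C)$. **Very general.** Let $\mathscr M_G^{\mathrm{tr}}=\mathbb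 R_{>0}^{E}/\mathrm{Aut}(G)$. A hypersurface in it is the image of the zero locus in $\mathbb R_{>0}^E$ of a nonconstant real polynomial. A property holds for a very general tropical curve overlying $G$ if it holds for every $\ell$ whose class lies outside some countable union of hypersurfaces. **Proposition.** Suppose $\alpha(G)\neq0$. Then a very general tropical curve $C$ overlying $G$ has $\alpha(C)\neq0$ (whatever the base point). Moreover there is a sequence $F_0,F_1,\dots$ of finite sets of polynomials in $\mathbb Z[x_e : e\in E]$, each containing a nonzero polynomial, such that for every $\ell\in\mathbb R_{>0}^E$, with associated curve $C$, and every base point, $\alpha(C)=0$ if and only if for some $n$ all polynomials in $F_n$ vanish at $\ell$. -/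

import Mathlib

open scoped TensorProduct ContDiff

noncomputable section

namespace CeresaPeriod

universe u v

/-! ### Multigraphs, simplicial chains and cycles -/

/-- A multigraph with vertex type `V` and edge type `E`, together with an (arbitrary) orientation:
the edge `e` runs from `tail e` (written `e⁻`) to `head e` (written `e⁺`).
Loops and parallel edges are allowed. -/
structure Multigraph (V : Type u) (E : Type v) where
  tail : E → V
  head : E → V

namespace Multigraph

variable {V : Type u} {E : Type v} (G : Multigraph V E)

/-- The graph is connected (as an unoriented graph, and in particular nonempty). -/
def Connected : Prop :=
  Nonempty V ∧ ∀ a b : V, Relation.EqvGen (fun p q => ∃ e, G.tail e = p ∧ G.head e = q) a b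

/-- The boundary map `C₁(G,ℤ) → C₀(G,ℤ)`, `e ↦ e⁺ - e⁻`. -/
def boundary₁ : (E →₀ ℤ) →ₗ[ℤ] (V →₀ ℤ) :=
  Finsupp.linearCombination ℤ fun e =>
    (Finsupp.single (G.head e) 1 - Finsupp.single (G.tail e) 1 : V →₀ ℤ)

/-- `H₁(G,ℤ) ⊆ C₁(G,ℤ)`. -/
def H₁ : Submodule ℤ (E →₀ ℤ) := LinearMap.ker G.boundary₁

/-- `N = H¹(G,ℤ) = Hom(H₁(G,ℤ),ℤ)`. -/
abbrev N : Type v := G.H₁ →ₗ[ℤ] ℤ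

/-- `N_A = H¹(G,A) = Hom(H₁(G,ℤ),A)` for a commutative ring `A`. -/
abbrev NExt (A : Type*) [CommRing A] : Type _ := G.H₁ →ₗ[ℤ] A

/-- The natural map `N → N_A`. -/
def incl (A : Type*) [CommRing A] : G.N →ₗ[ℤ] G.NExt A :=
  LinearMap.compRight ℤ (Algebra.linearMap ℤ A)

/-- `IsPath a b δ`: the 1-chain `δ` is the sum of the (signed) edges along a path (edge walk)
in the graph from `a` to `b`. -/
inductive IsPath (a : V) : V → (E →₀ ℤ) → Prop
  | nil : IsPath a a 0
  | forward {δ : E →₀ ℤ} (e : E) : IsPath a (G.tail e) δ →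
      IsPath a (G.head e) (δ + Finsupp.single e 1)
  | backward {δ : E →₀ ℤ} (e : E) : IsPath a (G.head e) δ →
      IsPath a (G.tail e) (δ - Finsupp.single e 1)

open Classical in
/-- A chosen path from `a` to `b` (there is one whenever the graph is connected). -/
def path (a b : V) : E →₀ ℤ := if h : ∃ δ, G.IsPath a b δ then h.choose else 0

/-! ### Length pairing and the lattice `Λ` -/

section Lengths

variable {A : Type*} [CommRing A] (x : E → A)

open Classical in
/-- The length pairing `C₁(G,ℤ) × C₁(G,ℤ) → A`, with `[e,e] = x e` and `[e,e'] = 0` for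
`e ≠ e'`. -/
def lengthPairing : (E →₀ ℤ) →ₗ[ℤ] (E →₀ ℤ) →ₗ[ℤ] A :=
  Finsupp.linearCombination ℤ fun e =>
    Finsupp.linearCombination ℤ fun e' => if e = e' then x e else 0

/-- `π : C₁(G,ℤ) → N_A`, `c ↦ [c,·]`. -/
def proj : (E →₀ ℤ) →ₗ[ℤ] G.NExt A :=
  LinearMap.lcomp ℤ A G.H₁.subtype ∘ₗ lengthPairing x

/-- `Λ = π(H₁(G,ℤ)) ⊆ N_A`. -/
def lattice : AddSubgroup (G.NExt A) :=
  (LinearMap.range (G.proj x ∘ₗ G.H₁.subtype)).toAddSubgroup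

/-- The element `x_e⁻¹ π(e)` of `N`, namely `γ ↦` multiplicity of `e` in `γ`
(see `smul_incl_edgeClass`). -/
def edgeClass (e : E) : G.N := Finsupp.lapply e ∘ₗ G.H₁.subtype

open Classical in
theorem smul_incl_edgeClass (e : E) :
    x e • G.incl A (G.edgeClass e) = G.proj x (Finsupp.single e 1) := by
  ext γ
  have h : G.proj x (Finsupp.single e 1) γ
      = Finsupp.linearCombination ℤ (fun e' => if e = e' then x e else 0) (γ : E →₀ ℤ) := by
    simp [proj, lengthPairing]
  rw [h, Finsupp.linearCombination_apply, Finsupp.sum, Finset.sum_eq_single e]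
  · simp [incl, edgeClass, mul_comm]
  · intro b _ hb
    simp [Ne.symm hb]
  · intro h
    simp [Finsupp.notMem_support_iff.mp h]

end Lengths

/-! ### The universal Jacobian and its chains -/

/-- `R = ℤ[x_e | e ∈ E(G)]`. -/
abbrev R (_ : Multigraph V E) : Type v := MvPolynomial E ℤ

/-- `N_R`. -/
abbrev NR : Type v := G.NExt G.R

/-- The universal projection `π : C₁(G,ℤ) → N_R`, with `x_e` as the length of `e`. -/
abbrev projU : (E →₀ ℤ) →ₗ[ℤ] G.NR := G.proj (MvPolynomial.X : E → G.R)

/-- The universal lattice `Λ ⊆ N_R`. -/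
abbrev latticeU : AddSubgroup G.NR := G.lattice (MvPolynomial.X : E → G.R)

/-- Ordered `q`-simplices in `N_R` are identified up to simultaneous translation by `Λ`. -/
def simplexSetoid (q : ℕ) : Setoid (Fin (q + 1) → G.NR) where
  r a b := ∃ c ∈ G.latticeU, ∀ i, b i = a i + c
  iseqv :=
    { refl := fun a => ⟨0, zero_mem _, fun i => by simp⟩
      symm := by
        rintro a b ⟨c, hc, h⟩
        exact ⟨-c, neg_mem hc, fun i => by simp [h i]⟩
      trans := by
        rintro a b d ⟨c, hc, h⟩ ⟨c', hc', h'⟩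
        exact ⟨c + c', add_mem hc hc', fun i => by rw [h' i, h i, add_assoc]⟩ }

/-- Ordered `q`-simplices of the universal Jacobian. -/
def Simplex (q : ℕ) : Type v := Quotient (G.simplexSetoid q)

/-- The class of the ordered simplex `(u₀,…,u_q)`. -/
def simplex {q : ℕ} (u : Fin (q + 1) → G.NR) : G.Simplex q := Quotient.mk (G.simplexSetoid q) u

/-- The `i`-th face, omitting the `i`-th vertex. -/
def face {q : ℕ} (i : Fin (q + 2)) : G.Simplex (q + 1) → G.Simplex q :=
  Quotient.map' (s₁ := G.simplexSetoid (q + 1)) (s₂ := G.simplexSetoid q)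
    (fun u => u ∘ i.succAbove) (by
      rintro a b ⟨c, hc, h⟩
      exact ⟨c, hc, fun j => h _⟩)

/-- The simplex `(-u₀,…,-u_q)`. -/
def negSimplex {q : ℕ} : G.Simplex q → G.Simplex q :=
  Quotient.map' (s₁ := G.simplexSetoid q) (s₂ := G.simplexSetoid q) (fun u => -u) (by
      rintro a b ⟨c, hc, h⟩
      exact ⟨-c, neg_mem hc, fun j => by simp [h j, add_comm]⟩)

/-- `C_q(Jac(G))`, the free abelian group on ordered `q`-simplices. -/
abbrev Chain (q : ℕ) : Type v := G.Simplex q →₀ ℤ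

/-- `C_{1,q}(Jac(G)) = N ⊗ C_q(Jac(G))`. -/
abbrev TChain (q : ℕ) : Type v := G.N ⊗[ℤ] G.Chain q

/-- `∂ : C_{q+1} → C_q`. -/
def boundary (q : ℕ) : G.Chain (q + 1) →ₗ[ℤ] G.Chain q :=
  ∑ i : Fin (q + 2), (-1 : ℤ) ^ (i : ℕ) • Finsupp.lmapDomain ℤ ℤ (G.face i)

/-- `∂ : C_{1,q+1} → C_{1,q}`, `n ⊗ σ ↦ n ⊗ ∂σ`. -/
def tBoundary (q : ℕ) : G.TChain (q + 1) →ₗ[ℤ] G.TChain q :=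
  LinearMap.lTensor G.N (G.boundary q)

/-- `[-1]_* : C_{1,q} → C_{1,q}`, `n ⊗ (u₀,…,u_q) ↦ (-n) ⊗ (-u₀,…,-u_q)`. -/
def negPush (q : ℕ) : G.TChain q →ₗ[ℤ] G.TChain q :=
  TensorProduct.map (-LinearMap.id) (Finsupp.lmapDomain ℤ ℤ G.negSimplex)

/-- The `(1,1)`-chain `Φ_a(e) = x_e⁻¹π(e) ⊗ (π(δ_e), π(δ_e + e))`, with `δ_e` a path from `a`
to `e⁻`. -/
def abelJacobiEdge (a : V) (e : E) : G.TChain 1 :=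
  G.edgeClass e ⊗ₜ Finsupp.single (G.simplex
    ![G.projU (G.path a (G.tail e)), G.projU (G.path a (G.tail e) + Finsupp.single e 1)]) 1

/-- The universal Ceresa cycle based at the vertex `a`. -/
def ceresaCycle [Fintype E] (a : V) : G.TChain 1 :=
  (∑ e, G.abelJacobiEdge a e) - G.negPush 1 (∑ e, G.abelJacobiEdge a e)

/-- `N_R^{∧3}`, the exterior power over `R`. -/
abbrev WedgeR : Type v := ⋀[G.R]^3 G.NR

/-- For fixed `p, q ∈ N_A`, the map `N → N_A^{∧3}`, `n ↦ n ∧ p ∧ q`. -/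
def wedgeLeft (A : Type*) [CommRing A] (p q : G.NExt A) : G.N →ₗ[ℤ] ⋀[A]^3 (G.NExt A) :=
  AddMonoidHom.toIntLinearMap
    { toFun := fun n => exteriorPower.ιMulti A 3 ![G.incl A n, p, q]
      map_zero' := by
        rw [map_zero]
        exact (exteriorPower.ιMulti A 3).map_coord_zero (0 : Fin 3) rfl
      map_add' := fun m n => by
        rw [map_add]
        exact (exteriorPower.ιMulti A 3).toMultilinearMap.cons_add ![p, q] _ _ }

/-- `Θ` on a simplex: `n ↦ n ∧ (u₁ - u₀) ∧ (u₂ - u₀)`. -/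
def thetaSimplex : G.Simplex 2 → (G.N →ₗ[ℤ] G.WedgeR) :=
  Quotient.lift (s := G.simplexSetoid 2)
    (fun u => G.wedgeLeft G.R (u 1 - u 0) (u 2 - u 0)) (by
      rintro a b ⟨c, _, h⟩
      simp [h])

/-- `Θ : C_{1,2}(Jac(G)) → N_R^{∧3}`. -/
def theta : G.TChain 2 →ₗ[ℤ] G.WedgeR :=
  TensorProduct.lift (Finsupp.linearCombination ℤ G.thetaSimplex).flip

/-- `𝒫 = Θ(H_{1,2}(Jac(G)))`, the image under `Θ` of the `(1,2)`-cycles. -/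
def periods : AddSubgroup G.WedgeR :=
  ((LinearMap.ker (G.tBoundary 1)).map G.theta).toAddSubgroup

open Classical in
/-- The universal Ceresa period `α(G) ∈ N_R^{∧3}/𝒫`, computed with the base vertex `a`: the class
of `Θ(Σ)` for any `Σ` with `∂Σ = Cer_a(G)` (and `0` if there were no such `Σ`). -/
def ceresaPeriod [Fintype E] (a : V) : G.WedgeR ⧸ G.periods :=
  if h : ∃ S : G.TChain 2, G.tBoundary 1 S = G.ceresaCycle a then
    QuotientAddGroup.mk (G.theta h.choose)
  else 0

/-! ### Tropical curves overlying `G` -/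

/-- Length functions `E(G) → ℝ_{>0}`; each presents the tropical curve with model `(G,ℓ)`. -/
abbrev Length (_ : Multigraph V E) : Type v := {l : E → ℝ // ∀ e, 0 < l e}

variable (l : G.Length)

/-- `N_ℝ = H¹(C,ℝ)`. -/
abbrev NReal : Type v := G.NExt ℝ

/-- `π_C : C₁(G,ℤ) → N_ℝ`. -/
abbrev projC : (E →₀ ℤ) →ₗ[ℤ] G.NReal := G.proj l.1

/-- The tropical Jacobian `Jac(C) = N_ℝ/Λ_C`. -/
abbrev Jac : Type v := G.NReal ⧸ G.lattice l.1

/-- A function from `ℝ^{q+1}` to the finite-dimensional real vector space `N_ℝ = Hom(H₁(G,ℤ),ℝ)`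
is smooth if all its coordinates `t ↦ f(t)(γ)` are. -/
def IsSmooth {q : ℕ} (f : (Fin (q + 1) → ℝ) → G.NReal) : Prop :=
  ∀ γ : G.H₁, ContDiff ℝ ∞ fun t => f t γ

/-- Smooth singular `q`-simplices `Δ^q → Jac(C)`: the maps that lift to a map `Δ^q → N_ℝ` which is
the restriction of a smooth map on `ℝ^{q+1}`. (As `Δ^q` is simply connected and compact, every
smooth map to the torus `N_ℝ/Λ_C` has such a lift.) -/
@[ext]
structure SmoothSimplex (q : ℕ) : Type v where
  toFun : stdSimplex ℝ (Fin (q + 1)) → G.Jac l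
  smooth : ∃ f : (Fin (q + 1) → ℝ) → G.NReal,
    G.IsSmooth f ∧ ∀ t, toFun t = QuotientAddGroup.mk (f t.1)

namespace SmoothSimplex

variable {G l}

/-- A smooth lift of a smooth simplex to the universal cover; it is unique on `Δ^q` up to
translation by an element of the lattice. -/
def lift {q : ℕ} (s : G.SmoothSimplex l q) : (Fin (q + 1) → ℝ) → G.NReal := s.smooth.choose

/-- The `i`-th face of a smooth simplex. -/
def face {q : ℕ} (i : Fin (q + 2)) (s : G.SmoothSimplex l (q + 1)) : G.SmoothSimplex l q :=
  ⟨fun t => s.toFun (stdSimplex.map i.succAbove t), by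
    obtain ⟨f, hf, h⟩ := s.smooth
    refine ⟨fun t => f (FunOnFinite.linearMap ℝ ℝ i.succAbove t), fun γ => ?_, fun t => h _⟩
    exact (hf γ).comp
      (LinearMap.toContinuousLinearMap (FunOnFinite.linearMap ℝ ℝ i.succAbove)).contDiff⟩

/-- The composition of a smooth simplex with `[-1] : Jac(C) → Jac(C)`. -/
def neg {q : ℕ} (s : G.SmoothSimplex l q) : G.SmoothSimplex l q :=
  ⟨fun t => -s.toFun t, by
    obtain ⟨f, hf, h⟩ := s.smooth
    refine ⟨fun t => -f t, fun γ => (hf γ).neg, fun t => ?_⟩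
    rw [h t]; rfl⟩

variable (l) in
/-- The affine simplex `(u₀,…,u_q)`. -/
def affine {q : ℕ} (p : Fin (q + 1) → G.NReal) : G.SmoothSimplex l q :=
  ⟨fun t => QuotientAddGroup.mk (∑ i, t.1 i • p i),
    fun t => ∑ i, t i • p i, fun γ => by
      simp only [LinearMap.sum_apply, LinearMap.smul_apply, smul_eq_mul]
      fun_prop, fun _ => rfl⟩

end SmoothSimplex

/-- `S_q(Jac(C))`. -/
abbrev SChain (q : ℕ) : Type v := G.SmoothSimplex l q →₀ ℤ

/-- `S_{1,q}(Jac(C)) = N ⊗ S_q(Jac(C))`. -/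
abbrev STChain (q : ℕ) : Type v := G.N ⊗[ℤ] G.SChain l q

/-- `∂ : S_{q+1} → S_q`. -/
def sBoundary (q : ℕ) : G.SChain l (q + 1) →ₗ[ℤ] G.SChain l q :=
  ∑ i : Fin (q + 2), (-1 : ℤ) ^ (i : ℕ) • Finsupp.lmapDomain ℤ ℤ (SmoothSimplex.face i)

/-- `∂ : S_{1,q+1} → S_{1,q}`. -/
def stBoundary (q : ℕ) : G.STChain l (q + 1) →ₗ[ℤ] G.STChain l q :=
  LinearMap.lTensor G.N (G.sBoundary l q)

/-- `[-1]_* : S_{1,q} → S_{1,q}`. -/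
def sNegPush (q : ℕ) : G.STChain l q →ₗ[ℤ] G.STChain l q :=
  TensorProduct.map (-LinearMap.id) (Finsupp.lmapDomain ℤ ℤ SmoothSimplex.neg)

/-- Points of the tropical curve with model `(G,ℓ)`: vertices, and the points of the segments
`[0,ℓ(e)]` (an endpoint of a segment being another name of a vertex). -/
inductive CurvePoint : Type (max u v)
  | vertex (a : V) : CurvePoint
  | onEdge (e : E) (t : Set.Icc (0 : ℝ) (l.1 e)) : CurvePoint

namespace CurvePoint

variable {G l}

/-- A vertex from which paths starting at the point `p` are continued: `p` itself, or the tail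
of the edge on which `p` lies. -/
def root : G.CurvePoint l → V
  | vertex a => a
  | onEdge e _ => G.tail e

/-- The value of `π_C` on the segment from `p` to `root p`: for the point at distance `t` from
`e⁻` on `e`, this is `-(t/ℓ(e)) π_C(e)`. -/
def offset : G.CurvePoint l → G.NReal
  | vertex _ => 0
  | onEdge e t => -((t.1 / l.1 e) • G.projC l (Finsupp.single e 1))

end CurvePoint

/-- `π_C(δ)` for a path `δ` in the curve from the point `p` to the vertex `b`, a lift to `N_ℝ` of
the Abel–Jacobi image of `b`. -/
def abelJacobiLift (p : G.CurvePoint l) (b : V) : G.NReal :=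
  p.offset + G.projC l (G.path p.root b)

/-- The edge `e` contributes the `(1,1)`-chain `ℓ(e)⁻¹π(e) ⊗ (π(δ_e), π(δ_e + e))` to the class of
the push-forward of the curve by the Abel–Jacobi map based at `p`, where `δ_e` is a path from `p`
to `e⁻`. -/
def sAbelJacobiEdge (p : G.CurvePoint l) (e : E) : G.STChain l 1 :=
  G.edgeClass e ⊗ₜ Finsupp.single (SmoothSimplex.affine l
    ![G.abelJacobiLift l p (G.tail e),
      G.abelJacobiLift l p (G.tail e) + G.projC l (Finsupp.single e 1)]) 1

/-- The tropical Ceresa cycle `Cer_p(C)` as a tropical `(1,1)`-chain. -/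
def tropicalCeresaCycle [Fintype E] (p : G.CurvePoint l) : G.STChain l 1 :=
  (∑ e, G.sAbelJacobiEdge l p e) - G.sNegPush l 1 (∑ e, G.sAbelJacobiEdge l p e)

section Integration

variable [Finite E]

instance : Module.Finite ℤ G.H₁ := inferInstanceAs (Module.Finite ℤ (LinearMap.ker G.boundary₁))

instance : Module.Free ℤ G.H₁ := inferInstanceAs (Module.Free ℤ (LinearMap.ker G.boundary₁))

/-- The genus `g`, the rank of `H₁(G,ℤ)`. -/
def genus : ℕ := Module.finrank ℤ G.H₁

/-- A basis `γ₁,…,γ_g` of `H₁(G,ℤ)`. The coordinate functions on `N_ℝ` that belong to the dual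
basis `ε₁,…,ε_g` of `N` are `z_i(u) = u(γ_i)`. -/
def cycleBasis : Module.Basis (Fin G.genus) ℤ G.H₁ := Module.finBasis ℤ G.H₁

/-- The dual basis `ε₁,…,ε_g` of `N`. -/
def cocycleBasis (i : Fin G.genus) : G.N := G.cycleBasis.coord i

/-- `∫_σ dz_i ∧ dz_j = ∫_{Δ²} σ^*(dz_i ∧ dz_j)`, where `Δ²` is parametrized (compatibly with its
orientation) by `(a,b) ↦ (1 - a - b, a, b)` for `a, b ≥ 0`, `a + b ≤ 1`. -/
def integral₂ (s : G.SmoothSimplex l 2) (i j : Fin G.genus) : ℝ :=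
  let z : Fin G.genus → ℝ × ℝ → ℝ := fun k p =>
    s.lift ![1 - p.1 - p.2, p.1, p.2] (G.cycleBasis k)
  ∫ p in {p : ℝ × ℝ | 0 ≤ p.1 ∧ 0 ≤ p.2 ∧ p.1 + p.2 ≤ 1},
    (fderiv ℝ (z i) p (1, 0) * fderiv ℝ (z j) p (0, 1)
      - fderiv ℝ (z i) p (0, 1) * fderiv ℝ (z j) p (1, 0))

/-- `N_ℝ^{∧3}`. -/
abbrev WedgeReal : Type v := ⋀[ℝ]^3 G.NReal

/-- `ε_i ∧ ε_j ∧ ε_k ∈ N_ℝ^{∧3}`. -/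
def wedgeBasis (i j k : Fin G.genus) : G.WedgeReal :=
  exteriorPower.ιMulti ℝ 3 ![G.incl ℝ (G.cocycleBasis i), G.incl ℝ (G.cocycleBasis j),
    G.incl ℝ (G.cocycleBasis k)]

/-- `Θ_C` on a smooth simplex `σ`: the element `n = ∑ n_i ε_i` is sent to
`2 ∑_{i<j<k} ∫_σ (n_i dz_j ∧ dz_k - n_j dz_i ∧ dz_k + n_k dz_i ∧ dz_j) ε_i ∧ ε_j ∧ ε_k`. -/
def sThetaSimplex (s : G.SmoothSimplex l 2) : G.N →ₗ[ℤ] G.WedgeReal :=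
  AddMonoidHom.toIntLinearMap
    { toFun := fun n =>
        (2 : ℝ) • ∑ I : Fin G.genus × Fin G.genus × Fin G.genus with I.1 < I.2.1 ∧ I.2.1 < I.2.2,
          ((n (G.cycleBasis I.1) : ℝ) * G.integral₂ l s I.2.1 I.2.2
            - (n (G.cycleBasis I.2.1) : ℝ) * G.integral₂ l s I.1 I.2.2
            + (n (G.cycleBasis I.2.2) : ℝ) * G.integral₂ l s I.1 I.2.1) •
              G.wedgeBasis I.1 I.2.1 I.2.2
      map_zero' := by simp
      map_add' := fun m n => by
        rw [← smul_add, ← Finset.sum_add_distrib]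
        congr 1
        refine Finset.sum_congr rfl fun I _ => ?_
        rw [← add_smul]
        congr 1
        simp only [LinearMap.add_apply, Int.cast_add]
        ring }

/-- The integration map `Θ_C : S_{1,2}(Jac(C)) → N_ℝ^{∧3}`. -/
def sTheta : G.STChain l 2 →ₗ[ℤ] G.WedgeReal :=
  TensorProduct.lift (Finsupp.linearCombination ℤ (G.sThetaSimplex l)).flip

/-- `𝒫_C = Θ_C(H_{1,2}(Jac(C)))`, the image under `Θ_C` of the tropical `(1,2)`-cycles. -/
def tropicalPeriods : AddSubgroup G.WedgeReal :=
  ((LinearMap.ker (G.stBoundary l 1)).map (G.sTheta l)).toAddSubgroup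

end Integration

open Classical in
/-- The Ceresa period `α(C) ∈ N_ℝ^{∧3}/𝒫_C` of the tropical curve with model `(G,ℓ)`, computed
with the base point `p`: the class of `Θ_C(Σ)` for any `Σ` with `∂Σ = Cer_p(C)` (and `0` if there
were no such `Σ`). -/
def tropicalCeresaPeriod [Fintype E] (p : G.CurvePoint l) : G.WedgeReal ⧸ G.tropicalPeriods l :=
  if h : ∃ S : G.STChain l 2, G.stBoundary l 1 S = G.tropicalCeresaCycle l p then
    QuotientAddGroup.mk (G.sTheta l h.choose)
  else 0

/-! ### Moduli of tropical curves overlying `G` -/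

/-- Automorphisms of the (unoriented) multigraph. -/
structure Auto where
  onV : V ≃ V
  onE : E ≃ E
  compat : ∀ e, s(G.tail (onE e), G.head (onE e)) = s(onV (G.tail e), onV (G.head e))

/-- Two length functions are equivalent if an automorphism of the graph carries one to the
other. -/
def lengthSetoid : Setoid G.Length where
  r l l' := ∃ φ : G.Auto, ∀ e, l'.1 (φ.onE e) = l.1 e
  iseqv :=
    { refl := fun l => ⟨⟨Equiv.refl _, Equiv.refl _, fun _ => rfl⟩, fun _ => rfl⟩
      symm := by
        rintro l l' ⟨φ, h⟩
        refine ⟨⟨φ.onV.symm, φ.onE.symm, fun e => ?_⟩, fun e => by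
          simpa using (h (φ.onE.symm e)).symm⟩
        apply Sym2.map.injective φ.onV.injective
        simpa using (φ.compat (φ.onE.symm e)).symm
      trans := by
        rintro l l' l'' ⟨φ, h⟩ ⟨ψ, h'⟩
        refine ⟨⟨φ.onV.trans ψ.onV, φ.onE.trans ψ.onE, fun e => ?_⟩, fun e => by
          simp [h', h]⟩
        have := congrArg (Sym2.map ψ.onV) (φ.compat e)
        simp only [Sym2.map_mk] at this
        simp only [Equiv.trans_apply, ψ.compat]
        exact this }

/-- `ℳ_G^tr = ℝ_{>0}^{E(G)}/Aut(G)`. -/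
def Moduli : Type v := Quotient G.lengthSetoid

/-- The point of `ℳ_G^tr` given by a length function. -/
def toModuli (l : G.Length) : G.Moduli := Quotient.mk G.lengthSetoid l

/-- Hypersurfaces in `ℳ_G^tr`: the images of the zero loci in `ℝ_{>0}^{E(G)}` of nonconstant
polynomials. -/
def IsHypersurface (Z : Set G.Moduli) : Prop :=
  ∃ f : MvPolynomial E ℝ, f.totalDegree ≠ 0 ∧
    Z = G.toModuli '' {l | MvPolynomial.eval l.1 f = 0}

/-- The property `P` holds for a very general tropical curve overlying `G`. -/
def VeryGeneral (P : G.Length → Prop) : Prop :=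
  ∃ 𝓗 : Set (Set G.Moduli), 𝓗.Countable ∧ (∀ Z ∈ 𝓗, G.IsHypersurface Z) ∧
    ∀ l : G.Length, G.toModuli l ∉ ⋃₀ 𝓗 → P l

end Multigraph

end CeresaPeriod

end

/-!
The substitution `x_e ↦ ℓ(e)` sends a simplex with vertices in `N_R` to an affine simplex of
`Jac(C)`. It maps a chain `Σ` that bounds the universal Ceresa cycle to a chain that bounds the
tropical one, and it intertwines `Θ` with `Θ_C`. Moreover `𝒫_C` is exactly the specialization of
`𝒫`: after lifting a smooth triangle to `N_ℝ`, Green's formula expresses the integral of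
`dz_i ∧ dz_j` through its edges, and on a two-cycle only the cup product of the periods of the edges
survives. These periods define an antisymmetric element of `H₁ ⊗ H₁`, which is a combination of the
classes of two-dimensional tori, and each such torus already comes from a universal two-cycle.

Hence `α(C) = 0` if and only if, for some `w` in the countable group `𝒫`, all coordinates of
`Θ(Σ) - w` vanish at `ℓ`; since `α(G) ≠ 0`, these coordinates are never all the zero polynomial.
Moving the base point changes the bounding chain by prisms over the edges `e`, with coefficient
`n_e` and one side parallel to `n_e`, and `Θ_C` vanishes on those.
-/

noncomputable section

namespace CeresaPeriod

universe u v

/-! ### Green's formula on a triangle -/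

section Green

open MeasureTheory intervalIntegral

/-- The standard triangle in the plane, over which `Multigraph.integral₂` integrates. -/
abbrev triangle : Set (ℝ × ℝ) := {p : ℝ × ℝ | 0 ≤ p.1 ∧ 0 ≤ p.2 ∧ p.1 + p.2 ≤ 1}

theorem isCompact_triangle : IsCompact triangle := by
  refine (isCompact_Icc (a := ((0 : ℝ), (0 : ℝ))) (b := (1, 1))).of_isClosed_subset ?_ ?_
  · exact (isClosed_le continuous_const continuous_fst).inter
      ((isClosed_le continuous_const continuous_snd).inter
        (isClosed_le (continuous_fst.add continuous_snd) continuous_const))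
  · rintro ⟨a, b⟩ ⟨ha, hb, hab⟩
    exact ⟨⟨ha, hb⟩, by dsimp only at *; linarith, by dsimp only at *; linarith⟩

section Fubini

variable {X : Type*} [NormedAddCommGroup X] [NormedSpace ℝ X] {F : ℝ × ℝ → X}

theorem integral_indicator_triangle (F : ℝ × ℝ → X) (a : ℝ) :
    ∫ b, triangle.indicator F (a, b) =
      (Set.Icc 0 1).indicator (fun a => ∫ b in (0 : ℝ)..(1 - a), F (a, b)) a := by
  by_cases ha : a ∈ Set.Icc (0 : ℝ) 1
  · have hslice : (fun b => triangle.indicator F (a, b)) =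
        (Set.Icc 0 (1 - a)).indicator fun b => F (a, b) := by
      ext b
      simp only [Set.indicator, Set.mem_ofPred_eq, Set.mem_Icc, ha.1, true_and, le_sub_iff_add_le']
    rw [Set.indicator_of_mem ha, hslice, MeasureTheory.integral_indicator measurableSet_Icc,
      integral_Icc_eq_integral_Ioc, integral_of_le (by linarith [ha.2])]
  · have hslice (b : ℝ) : triangle.indicator F (a, b) = 0 :=
      Set.indicator_of_notMem (fun h => ha ⟨h.1, by linarith [h.2.1, h.2.2]⟩) _
    simp only [hslice, integral_zero, Set.indicator_of_notMem ha]

theorem setIntegral_triangle (hF : ContinuousOn F triangle) :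
    ∫ p in triangle, F p = ∫ a in (0 : ℝ)..1, ∫ b in (0 : ℝ)..(1 - a), F (a, b) := by
  have hmeas : MeasurableSet triangle := isCompact_triangle.isClosed.measurableSet
  have hinteg : Integrable (triangle.indicator F) (volume.prod volume) := by
    rw [← Measure.volume_eq_prod, integrable_indicator_iff hmeas]
    exact hF.integrableOn_compact isCompact_triangle
  rw [← MeasureTheory.integral_indicator hmeas, Measure.volume_eq_prod, integral_prod _ hinteg,
    integral_of_le zero_le_one, ← integral_Icc_eq_integral_Ioc,
    ← MeasureTheory.integral_indicator measurableSet_Icc]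
  simp only [integral_indicator_triangle]

theorem setIntegral_triangle_comp_swap (F : ℝ × ℝ → X) :
    ∫ p in triangle, F p.swap = ∫ p in triangle, F p := by
  have hswap : MeasurePreserving (Prod.swap : ℝ × ℝ → ℝ × ℝ) := Measure.measurePreserving_swap
  have hpre : Prod.swap ⁻¹' triangle = triangle := by
    ext ⟨a, b⟩
    simp only [Set.mem_preimage, Set.mem_ofPred_eq, Prod.swap_prod_mk, add_comm b a]
    tauto
  conv_lhs => rw [← hpre]
  exact hswap.setIntegral_preimage_emb MeasurableEquiv.prodComm.measurableEmbedding F triangle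

theorem setIntegral_triangle_swap (hF : Continuous F) :
    ∫ p in triangle, F p = ∫ b in (0 : ℝ)..1, ∫ a in (0 : ℝ)..(1 - b), F (a, b) := by
  rw [← setIntegral_triangle_comp_swap,
    setIntegral_triangle (F := fun p => F p.swap) (hF.comp continuous_swap).continuousOn]
  rfl

end Fubini

section PartialDerivatives

variable {X : Type*} [NormedAddCommGroup X] [NormedSpace ℝ X] {F : ℝ × ℝ → X}

theorem hasDerivAt_fst (hF : Differentiable ℝ F) (a b : ℝ) :
    HasDerivAt (fun a => F (a, b)) (fderiv ℝ F (a, b) (1, 0)) a :=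
  (hF (a, b)).hasFDerivAt.comp_hasDerivAt a ((hasDerivAt_id a).prodMk (hasDerivAt_const a b))

theorem hasDerivAt_snd (hF : Differentiable ℝ F) (a b : ℝ) :
    HasDerivAt (fun b => F (a, b)) (fderiv ℝ F (a, b) (0, 1)) b :=
  (hF (a, b)).hasFDerivAt.comp_hasDerivAt b ((hasDerivAt_const b a).prodMk (hasDerivAt_id b))

theorem hasDerivAt_antidiagonal (hF : Differentiable ℝ F) (t : ℝ) :
    HasDerivAt (fun t => F (1 - t, t))
      (fderiv ℝ F (1 - t, t) (0, 1) - fderiv ℝ F (1 - t, t) (1, 0)) t := by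
  have hline : HasDerivAt (fun t : ℝ => (1 - t, t)) (-1, 1) t :=
    ((hasDerivAt_id t).const_sub 1).prodMk (hasDerivAt_id t)
  rw [← map_sub, Prod.mk_sub_mk, zero_sub, sub_zero]
  exact HasFDerivAt.comp_hasDerivAt (f := fun t : ℝ => (1 - t, t)) t
    (hF (1 - t, t)).hasFDerivAt hline

variable [CompleteSpace X]

theorem setIntegral_triangle_fderiv_fst (hF : ContDiff ℝ 1 F) :
    ∫ p in triangle, fderiv ℝ F p (1, 0) = ∫ b in (0 : ℝ)..1, (F (1 - b, b) - F (0, b)) := by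
  have hcont : Continuous fun p => fderiv ℝ F p (1, 0) :=
    (hF.continuous_fderiv one_ne_zero).clm_apply continuous_const
  rw [setIntegral_triangle_swap hcont]
  refine integral_congr fun b _ => integral_eq_sub_of_hasDerivAt
    (fun a _ => hasDerivAt_fst (hF.differentiable one_ne_zero) a b)
    ((hcont.comp (Continuous.prodMk_left b)).intervalIntegrable _ _)

theorem setIntegral_triangle_fderiv_snd (hF : ContDiff ℝ 1 F) :
    ∫ p in triangle, fderiv ℝ F p (0, 1) = ∫ a in (0 : ℝ)..1, (F (a, 1 - a) - F (a, 0)) := by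
  have hcont : Continuous fun p => fderiv ℝ F p (0, 1) :=
    (hF.continuous_fderiv one_ne_zero).clm_apply continuous_const
  rw [setIntegral_triangle hcont.continuousOn]
  refine integral_congr fun a _ => integral_eq_sub_of_hasDerivAt
    (fun b _ => hasDerivAt_snd (hF.differentiable one_ne_zero) a b)
    ((hcont.comp (Continuous.prodMk_right a)).intervalIntegrable _ _)

theorem setIntegral_triangle_curl {P Q : ℝ × ℝ → X} (hP : ContDiff ℝ 1 P) (hQ : ContDiff ℝ 1 Q) :
    ∫ p in triangle, (fderiv ℝ Q p (1, 0) - fderiv ℝ P p (0, 1)) =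
      (∫ t in (0 : ℝ)..1, (Q (1 - t, t) - P (1 - t, t))) - (∫ t in (0 : ℝ)..1, Q (0, t))
        + ∫ t in (0 : ℝ)..1, P (t, 0) := by
  have hinteg {F : ℝ × ℝ → X} (hF : ContDiff ℝ 1 F) (w : ℝ × ℝ) :
      IntegrableOn (fun p => fderiv ℝ F p w) triangle :=
    ((hF.continuous_fderiv one_ne_zero).clm_apply
      continuous_const).continuousOn.integrableOn_compact isCompact_triangle
  have hedge {F : ℝ × ℝ → X} (hF : ContDiff ℝ 1 F) {c : ℝ → ℝ × ℝ} (hc : Continuous c) :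
      IntervalIntegrable (fun t => F (c t)) volume 0 1 :=
    (hF.continuous.comp hc).intervalIntegrable _ _
  have hrev : ∫ t in (0 : ℝ)..1, P (t, 1 - t) = ∫ t in (0 : ℝ)..1, P (1 - t, t) := by
    simpa using integral_comp_sub_left (a := 0) (b := 1) (fun t => P (1 - t, t)) 1
  rw [integral_sub (hinteg hQ _) (hinteg hP _), setIntegral_triangle_fderiv_fst hQ,
    setIntegral_triangle_fderiv_snd hP,
    intervalIntegral.integral_sub (hedge hQ (by fun_prop)) (hedge hQ (by fun_prop)),
    intervalIntegral.integral_sub (hedge hP (by fun_prop)) (hedge hP (by fun_prop)),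
    intervalIntegral.integral_sub (hedge hQ (by fun_prop)) (hedge hP (by fun_prop)), hrev]
  abel

end PartialDerivatives

/-- The integral of `f dh` along the unit interval. -/
def lineIntegral (f h : ℝ → ℝ) : ℝ := ∫ t in (0 : ℝ)..1, f t * deriv h t

theorem fderiv_mul_fderiv_apply {f h : ℝ × ℝ → ℝ} (hf : ContDiff ℝ 1 f) (hh : ContDiff ℝ 2 h)
    (p v w : ℝ × ℝ) :
    fderiv ℝ (fun p => f p * fderiv ℝ h p w) p v =
      fderiv ℝ f p v * fderiv ℝ h p w + f p * fderiv ℝ (fderiv ℝ h) p v w := by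
  have hh' : Differentiable ℝ (fderiv ℝ h) :=
    (hh.fderiv_right (m := 1) le_rfl).differentiable one_ne_zero
  rw [fderiv_fun_mul (hf.differentiable one_ne_zero p)
    ((hh' p).clm_apply (differentiableAt_const w)), fderiv_clm_apply (hh' p)
    (differentiableAt_const w)]
  simp only [fderiv_fun_const, Pi.zero_apply, ContinuousLinearMap.comp_zero, zero_add, add_apply,
    smul_apply, ContinuousLinearMap.flip_apply, smul_eq_mul]
  ring

/-- Green's formula for the form `f dh`, as `df ∧ dh = d (f dh)`. -/
theorem setIntegral_triangle_fderiv_wedge {f h : ℝ × ℝ → ℝ} (hf : ContDiff ℝ 1 f)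
    (hh : ContDiff ℝ 2 h) :
    ∫ p in triangle, (fderiv ℝ f p (1, 0) * fderiv ℝ h p (0, 1)
        - fderiv ℝ f p (0, 1) * fderiv ℝ h p (1, 0)) =
      lineIntegral (fun t => f (1 - t, t)) (fun t => h (1 - t, t))
        - lineIntegral (fun t => f (0, t)) (fun t => h (0, t))
        + lineIntegral (fun t => f (t, 0)) (fun t => h (t, 0)) := by
  have hcoeff (w : ℝ × ℝ) : ContDiff ℝ 1 fun p => f p * fderiv ℝ h p w :=
    hf.mul ((hh.fderiv_right le_rfl).clm_apply contDiff_const)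
  have hsymm (p v w : ℝ × ℝ) : fderiv ℝ (fderiv ℝ h) p v w = fderiv ℝ (fderiv ℝ h) p w v :=
    hh.contDiffAt.isSymmSndFDerivAt (by simp) v w
  have hcurl (p : ℝ × ℝ) : fderiv ℝ f p (1, 0) * fderiv ℝ h p (0, 1)
        - fderiv ℝ f p (0, 1) * fderiv ℝ h p (1, 0) =
      fderiv ℝ (fun p => f p * fderiv ℝ h p (0, 1)) p (1, 0)
        - fderiv ℝ (fun p => f p * fderiv ℝ h p (1, 0)) p (0, 1) := by
    rw [fderiv_mul_fderiv_apply hf hh, fderiv_mul_fderiv_apply hf hh, hsymm p (1, 0) (0, 1)]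
    ring
  have hdiff : Differentiable ℝ h := hh.differentiable two_ne_zero
  simp only [hcurl, setIntegral_triangle_curl (hcoeff _) (hcoeff _), lineIntegral,
    (hasDerivAt_antidiagonal hdiff _).deriv, (hasDerivAt_fst hdiff _ _).deriv,
    (hasDerivAt_snd hdiff _ _).deriv, mul_sub]

theorem deriv_eq_of_eq_add_const {h h₀ : ℝ → ℝ} {d : ℝ} (hh : Differentiable ℝ h)
    (hh₀ : Differentiable ℝ h₀) (heq : ∀ t ∈ Set.Icc (0 : ℝ) 1, h t = h₀ t + d) {t : ℝ}
    (ht : t ∈ Set.Icc (0 : ℝ) 1) : deriv h t = deriv h₀ t := by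
  have hu := uniqueDiffOn_Icc (zero_lt_one (α := ℝ)) t ht
  rw [← (hh t).derivWithin hu, ← (hh₀ t).derivWithin hu, derivWithin_congr heq (heq t ht),
    derivWithin_add_const]

theorem lineIntegral_add_const {f h f₀ h₀ : ℝ → ℝ} {c d : ℝ} (hf₀ : Continuous f₀)
    (hh : Differentiable ℝ h) (hh₀ : ContDiff ℝ 1 h₀)
    (hf : ∀ t ∈ Set.Icc (0 : ℝ) 1, f t = f₀ t + c)
    (hd : ∀ t ∈ Set.Icc (0 : ℝ) 1, h t = h₀ t + d) :
    lineIntegral f h = lineIntegral f₀ h₀ + c * (h₀ 1 - h₀ 0) := by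
  have hdiff : Differentiable ℝ h₀ := hh₀.differentiable one_ne_zero
  have hcont : Continuous (deriv h₀) := hh₀.continuous_deriv le_rfl
  have hcongr : lineIntegral f h = ∫ t in (0 : ℝ)..1, (f₀ t * deriv h₀ t + c * deriv h₀ t) := by
    refine integral_congr fun t ht => ?_
    rw [Set.uIcc_of_le zero_le_one] at ht
    simp only [hf t ht, deriv_eq_of_eq_add_const hh hdiff hd ht, add_mul]
  rw [hcongr, integral_add ((hf₀.fun_mul hcont).intervalIntegrable _ _)
    ((continuous_const.fun_mul hcont).intervalIntegrable _ _), intervalIntegral.integral_const_mul,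
    integral_deriv_eq_sub (fun t _ => hdiff t) (hcont.intervalIntegrable _ _), lineIntegral]

end Green

/-! ### Multilinear algebra -/

section MultilinearAlgebra

section WedgeBilin

variable {A M : Type*} [CommRing A] [AddCommGroup M] [Module A M]

/-- The bilinear map `(p, q) ↦ n ∧ p ∧ q`. -/
def wedgeBilin (n : M) : M →ₗ[A] M →ₗ[A] ⋀[A]^3 M :=
  (AlternatingMap.constLinearEquivOfIsEmpty (ι := Fin 0)).symm.toLinearMap.compRight A ∘ₗ
    AlternatingMap.curryLeftLinearMap ∘ₗ ((exteriorPower.ιMulti A 3).curryLeft n).curryLeft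

theorem wedgeBilin_apply (n p q : M) :
    wedgeBilin n p q = exteriorPower.ιMulti A 3 ![n, p, q] := rfl

theorem isAlt_wedgeBilin (n : M) : (wedgeBilin n : M →ₗ[A] M →ₗ[A] ⋀[A]^3 M).IsAlt :=
  fun p => (exteriorPower.ιMulti A 3).map_eq_zero_of_eq ![n, p, p] (i := 1) (j := 2) rfl (by decide)

theorem wedgeBilin_self (n p : M) : wedgeBilin (A := A) n n p = 0 :=
  (exteriorPower.ιMulti A 3).map_eq_zero_of_eq ![n, n, p] (i := 0) (j := 1) rfl (by decide)

end WedgeBilin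

section ExteriorPower

variable {A B M M' : Type*} [CommRing A] [CommRing B] [AddCommGroup M] [Module A M]
  [AddCommGroup M'] [Module B M'] {m k : ℕ}

theorem sum_powersetCard_three {X : Type*} [AddCommMonoid X] (f : (Fin 3 → Fin m) → X) :
    ∑ s : Set.powersetCard (Fin m) 3, f (Set.powersetCard.ofFinEmbEquiv.symm s) =
      ∑ I : Fin m × Fin m × Fin m with I.1 < I.2.1 ∧ I.2.1 < I.2.2, f ![I.1, I.2.1, I.2.2] := by
  rw [Equiv.sum_comp (Set.powersetCard.ofFinEmbEquiv (n := 3) (I := Fin m)).symm (fun g => f g)]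
  refine Finset.sum_bij (fun g _ => (g 0, g 1, g 2)) (fun g _ => by simp) ?_ ?_ ?_
  · intro g _ h _ hgh
    simp only [Prod.mk.injEq] at hgh
    ext i
    fin_cases i <;> simp [hgh]
  · rintro ⟨i, j, k⟩ hijk
    obtain ⟨hij, hjk⟩ := (Finset.mem_filter.1 hijk).2
    refine ⟨OrderEmbedding.ofStrictMono ![i, j, k] (Fin.strictMono_iff_lt_succ.2 fun a => ?_),
      Finset.mem_univ _, rfl⟩
    fin_cases a
    exacts [hij, hjk]
  · intro g _
    congr 1
    ext i
    fin_cases i <;> rfl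

theorem repr_exteriorPower_ιMulti (b : Module.Basis (Fin m) A M) (v : Fin k → M)
    (s : Set.powersetCard (Fin m) k) :
    (b.exteriorPower k).repr (exteriorPower.ιMulti A k v) s =
      (Matrix.of fun i j => b.repr (v i) (Set.powersetCard.ofFinEmbEquiv.symm s j)).det := by
  rw [exteriorPower.basis_repr_apply, exteriorPower.ιMultiDual_apply_ιMulti]
  rfl

/-- The wedge product of `n` with the bivector `∑_{i<j} Ω i j • b i ∧ b j`. Only the entries of `Ω`
above the diagonal matter. -/
def wedgeBivector (b : Module.Basis (Fin m) A M) (n : M) :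
    Matrix (Fin m) (Fin m) A →ₗ[A] ⋀[A]^3 M where
  toFun Ω := ∑ I : Fin m × Fin m × Fin m with I.1 < I.2.1 ∧ I.2.1 < I.2.2,
    (b.repr n I.1 * Ω I.2.1 I.2.2 - b.repr n I.2.1 * Ω I.1 I.2.2 + b.repr n I.2.2 * Ω I.1 I.2.1) •
      exteriorPower.ιMulti A 3 ![b I.1, b I.2.1, b I.2.2]
  map_add' Ω Ω' := by
    rw [← Finset.sum_add_distrib]
    refine Finset.sum_congr rfl fun I _ => ?_
    rw [← add_smul]
    simp only [Matrix.add_apply]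
    ring_nf
  map_smul' a Ω := by
    rw [Finset.smul_sum]
    refine Finset.sum_congr rfl fun I _ => ?_
    rw [smul_smul]
    simp only [Matrix.smul_apply, smul_eq_mul, RingHom.id_apply]
    ring_nf

theorem wedgeBilin_eq_wedgeBivector (b : Module.Basis (Fin m) A M) (n p q : M) :
    wedgeBilin n p q = wedgeBivector b n
      (Matrix.of fun i j => b.repr p i * b.repr q j - b.repr p j * b.repr q i) := by
  rw [wedgeBilin_apply, ← (b.exteriorPower 3).sum_repr (exteriorPower.ιMulti A 3 ![n, p, q])]
  simp only [repr_exteriorPower_ιMulti, exteriorPower.basis_apply, exteriorPower.ιMulti_family]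
  rw [sum_powersetCard_three fun g : Fin 3 → Fin m =>
    (Matrix.of fun i j => b.repr (![n, p, q] i) (g j)).det • exteriorPower.ιMulti A 3 (b ∘ g)]
  refine Finset.sum_congr rfl fun I _ => ?_
  congr 2
  · rw [Matrix.det_fin_three]
    simp only [Matrix.of_apply, Matrix.cons_val_zero, Matrix.cons_val_one, Matrix.cons_val]
    ring
  · ext i : 1
    fin_cases i <;> rfl

/-- The map `⋀ᵏ M → ⋀ᵏ M'` over a ring homomorphism `φ` that sends `b i₁ ∧ ⋯ ∧ b iₖ` to
`b' i₁ ∧ ⋯ ∧ b' iₖ`: the exterior power of the `φ`-linear map with `b i ↦ b' i`. -/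
def mapExteriorPower (b : Module.Basis (Fin m) A M) (b' : Module.Basis (Fin m) B M') (φ : A →+* B)
    (k : ℕ) : ⋀[A]^k M →ₗ[ℤ] ⋀[B]^k M' :=
  AddMonoidHom.toIntLinearMap
    { toFun := fun w => ∑ s, φ ((b.exteriorPower k).repr w s) • b'.exteriorPower k s
      map_zero' := by simp
      map_add' := by simp [add_smul, Finset.sum_add_distrib] }

variable (b : Module.Basis (Fin m) A M) (b' : Module.Basis (Fin m) B M') (φ : A →+* B)

theorem repr_mapExteriorPower (w : ⋀[A]^k M) (s : Set.powersetCard (Fin m) k) :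
    (b'.exteriorPower k).repr (mapExteriorPower b b' φ k w) s =
      φ ((b.exteriorPower k).repr w s) := by
  change (b'.exteriorPower k).repr (∑ t, _ • b'.exteriorPower k t) s = _
  rw [Module.Basis.repr_sum_self]

theorem mapExteriorPower_eq_zero_iff (w : ⋀[A]^k M) :
    mapExteriorPower b b' φ k w = 0 ↔ ∀ s, φ ((b.exteriorPower k).repr w s) = 0 := by
  simp only [← repr_mapExteriorPower b b' φ, ← (b'.exteriorPower k).repr.map_eq_zero_iff,
    Finsupp.ext_iff, Finsupp.zero_apply]

theorem mapExteriorPower_ιMulti {v : Fin k → M} {v' : Fin k → M'}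
    (hv : ∀ i j, b'.repr (v' i) j = φ (b.repr (v i) j)) :
    mapExteriorPower b b' φ k (exteriorPower.ιMulti A k v) = exteriorPower.ιMulti B k v' := by
  refine (b'.exteriorPower k).repr.injective (Finsupp.ext fun s => ?_)
  rw [repr_mapExteriorPower, repr_exteriorPower_ιMulti, repr_exteriorPower_ιMulti, RingHom.map_det]
  simp only [hv]
  rfl

end ExteriorPower

section Tensor

theorem tensor_finsupp_hom_ext {N X M : Type*} [AddCommGroup N] [AddCommGroup M]
    {f g : N ⊗[ℤ] (X →₀ ℤ) →ₗ[ℤ] M}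
    (h : ∀ n x, f (n ⊗ₜ Finsupp.single x 1) = g (n ⊗ₜ Finsupp.single x 1)) : f = g :=
  TensorProduct.ext (LinearMap.ext fun n => Finsupp.lhom_ext' fun x => LinearMap.ext_ring (h n x))

theorem sum_sum_eq_sum_lt {ι M : Type*} [Fintype ι] [LinearOrder ι] [AddCommMonoid M]
    {T : ι → ι → M} (hdiag : ∀ i, T i i = 0) :
    ∑ i, ∑ j, T i j = ∑ i, ∑ j, if i < j then T i j + T j i else 0 := by
  have hsplit (i j : ι) :
      T i j = (if i < j then T i j else 0) + if j < i then T i j else 0 := by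
    rcases lt_trichotomy i j with h | rfl | h
    · simp [h, h.not_gt]
    · simp [hdiag]
    · simp [h, h.not_gt]
  calc ∑ i, ∑ j, T i j
      = (∑ i, ∑ j, if i < j then T i j else 0) + ∑ i, ∑ j, if j < i then T i j else 0 := by
        simp only [← Finset.sum_add_distrib, ← hsplit]
    _ = (∑ i, ∑ j, if i < j then T i j else 0) + ∑ i, ∑ j, if i < j then T j i else 0 := by
        rw [Finset.sum_comm (f := fun i j => if j < i then T i j else 0)]
    _ = _ := by simp only [← Finset.sum_add_distrib, ite_add_ite, add_zero]

variable {R M : Type*} [CommRing R] [AddCommGroup M] [Module R M]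

theorem repr_tensorProduct_comm {ι : Type*} (b : Module.Basis ι R M) (c : M ⊗[R] M) (i j : ι) :
    (b.tensorProduct b).repr (TensorProduct.comm R M M c) (i, j) =
      (b.tensorProduct b).repr c (j, i) := by
  induction c with
  | zero => simp
  | add x y hx hy => simp [hx, hy]
  | tmul x y =>
    rw [TensorProduct.comm_tmul, Module.Basis.tensorProduct_repr_tmul_apply,
      Module.Basis.tensorProduct_repr_tmul_apply, smul_eq_mul, smul_eq_mul, mul_comm]

theorem mem_span_tmul_sub_tmul_of_comm_eq_neg [IsAddTorsionFree R] {ι : Type*} [Finite ι]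
    [LinearOrder ι] (b : Module.Basis ι R M) {c : M ⊗[R] M} (hc : TensorProduct.comm R M M c = -c) :
    c ∈ Submodule.span R (Set.range fun p : M × M => p.1 ⊗ₜ[R] p.2 - p.2 ⊗ₜ[R] p.1) := by
  have := Fintype.ofFinite ι
  have hanti (i j : ι) :
      (b.tensorProduct b).repr c (j, i) = -(b.tensorProduct b).repr c (i, j) := by
    rw [← Finsupp.neg_apply, ← map_neg, ← hc, repr_tensorProduct_comm]
  have hsum : c = ∑ i, ∑ j,
      if i < j then (b.tensorProduct b).repr c (i, j) • (b i ⊗ₜ b j - b j ⊗ₜ b i) else 0 := by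
    conv_lhs => rw [← (b.tensorProduct b).sum_repr c, Fintype.sum_prod_type]
    rw [sum_sum_eq_sum_lt fun i => ?_]
    · refine Finset.sum_congr rfl fun i _ => Finset.sum_congr rfl fun j _ => ?_
      rw [Module.Basis.tensorProduct_apply, Module.Basis.tensorProduct_apply, hanti i j, neg_smul,
        ← sub_eq_add_neg, smul_sub]
    · rw [self_eq_neg.mp (hanti i i), zero_smul]
  rw [hsum]
  refine Submodule.sum_mem _ fun i _ => Submodule.sum_mem _ fun j _ => ?_
  split_ifs
  · exact Submodule.smul_mem _ _ (Submodule.subset_span ⟨(b i, b j), rfl⟩)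
  · exact Submodule.zero_mem _

theorem sum_coord_tmul_dualTensorHom {ι N : Type*} [Fintype ι] [AddCommGroup N] [Module R N]
    (b : Module.Basis ι R M) (c : Module.Dual R M ⊗[R] N) :
    ∑ i, b.coord i ⊗ₜ[R] dualTensorHom R M N c (b i) = c := by
  classical
  refine (dualTensorHomEquivOfBasis b).injective (b.ext fun j => ?_)
  simp [Finsupp.single_apply]

end Tensor

end MultilinearAlgebra

namespace Multigraph

variable {V : Type u} {E : Type v} (G : Multigraph V E)

/-! ### Change of coefficients -/

section Coefficients

variable {A B : Type*} [CommRing A] [CommRing B] (φ : A →+* B)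

/-- The map `N_A → N_B` induced by a ring homomorphism `A → B`. -/
def mapNExt : G.NExt A →ₗ[ℤ] G.NExt B :=
  LinearMap.compRight ℤ φ.toAddMonoidHom.toIntLinearMap

@[simp]
theorem mapNExt_apply (f : G.NExt A) (γ : G.H₁) : G.mapNExt φ f γ = φ (f γ) := rfl

@[simp]
theorem incl_apply (n : G.N) (γ : G.H₁) : G.incl A n γ = (n γ : A) := by
  simp [incl]

theorem mapNExt_incl (n : G.N) : G.mapNExt φ (G.incl A n) = G.incl B n := by
  ext γ
  simp

theorem proj_single_apply (x : E → A) (e : E) (γ : G.H₁) :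
    G.proj x (Finsupp.single e 1) γ = ((γ : E →₀ ℤ) e : A) * x e := by
  rw [← smul_incl_edgeClass, LinearMap.smul_apply, incl_apply, smul_eq_mul, mul_comm]
  rfl

theorem mapNExt_proj (x : E → A) (c : E →₀ ℤ) :
    G.mapNExt φ (G.proj x c) = G.proj (φ ∘ x) c := by
  suffices h : G.mapNExt φ ∘ₗ G.proj x = G.proj (φ ∘ x) from LinearMap.congr_fun h c
  ext e γ
  simp [proj_single_apply]

theorem proj_apply_eq_sum [Fintype E] (x : E → A) (c : E →₀ ℤ) (γ : G.H₁) :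
    G.proj x c γ = ∑ e, (c e : A) * ((γ : E →₀ ℤ) e : A) * x e := by
  conv_lhs => rw [← Finsupp.univ_sum_single c]
  rw [map_sum, LinearMap.sum_apply]
  refine Finset.sum_congr rfl fun e _ => ?_
  rw [← mul_one (c e), ← smul_eq_mul, ← Finsupp.smul_single, map_smul, LinearMap.smul_apply,
    proj_single_apply, zsmul_eq_mul, smul_eq_mul, mul_one, mul_assoc]

variable [Finite E]

/-- The basis of `N_A` dual to the basis of cycles. -/
def basisNExt (A : Type*) [CommRing A] : Module.Basis (Fin G.genus) A (G.NExt A) :=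
  Module.Basis.ofEquivFun (G.cycleBasis.constr A).symm

@[simp]
theorem basisNExt_repr (f : G.NExt A) (i : Fin G.genus) :
    (G.basisNExt A).repr f i = f (G.cycleBasis i) := by
  simp [basisNExt, Module.Basis.constr]

theorem basisNExt_eq_incl (i : Fin G.genus) :
    G.basisNExt A i = G.incl A (G.cocycleBasis i) := by
  refine G.cycleBasis.ext fun j => ?_
  rw [← basisNExt_repr]
  simp [cocycleBasis, Finsupp.single_apply, eq_comm]

/-- The map `⋀³ N_A → ⋀³ N_B` induced by a ring homomorphism `A → B`. -/
abbrev mapWedge : ⋀[A]^3 (G.NExt A) →ₗ[ℤ] ⋀[B]^3 (G.NExt B) :=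
  mapExteriorPower (G.basisNExt A) (G.basisNExt B) φ 3

theorem mapWedge_wedgeBilin (n p q : G.NExt A) :
    G.mapWedge φ (wedgeBilin n p q) =
      wedgeBilin (G.mapNExt φ n) (G.mapNExt φ p) (G.mapNExt φ q) := by
  rw [wedgeBilin_apply, mapWedge, mapExteriorPower_ιMulti (v' := G.mapNExt φ ∘ ![n, p, q]),
    wedgeBilin_apply]
  · congr 1
    ext i : 1
    fin_cases i <;> rfl
  · simp

end Coefficients

variable (l : G.Length)

/-! ### The maps on chains -/

section Chains

variable {q : ℕ}

theorem tBoundary_tmul (n : G.N) (c : G.Chain (q + 1)) :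
    G.tBoundary q (n ⊗ₜ c) = n ⊗ₜ G.boundary q c := rfl

theorem stBoundary_tmul (n : G.N) (c : G.SChain l (q + 1)) :
    G.stBoundary l q (n ⊗ₜ c) = n ⊗ₜ G.sBoundary l q c := rfl

theorem boundary_single (s : G.Simplex (q + 1)) :
    G.boundary q (Finsupp.single s 1) =
      ∑ i : Fin (q + 2), (-1 : ℤ) ^ (i : ℕ) • Finsupp.single (G.face i s) 1 := by
  simp only [boundary, LinearMap.sum_apply, LinearMap.smul_apply, Finsupp.lmapDomain_apply,
    Finsupp.mapDomain_single]

theorem sBoundary_single (s : G.SmoothSimplex l (q + 1)) :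
    G.sBoundary l q (Finsupp.single s 1) =
      ∑ i : Fin (q + 2), (-1 : ℤ) ^ (i : ℕ) • Finsupp.single (s.face i) 1 := by
  simp only [sBoundary, LinearMap.sum_apply, LinearMap.smul_apply, Finsupp.lmapDomain_apply,
    Finsupp.mapDomain_single]

theorem negPush_tmul_single (n : G.N) (s : G.Simplex q) :
    G.negPush q (n ⊗ₜ Finsupp.single s 1) = -(n ⊗ₜ Finsupp.single (G.negSimplex s) 1) := by
  change (-n) ⊗ₜ Finsupp.mapDomain G.negSimplex (Finsupp.single s 1) = _
  rw [Finsupp.mapDomain_single, TensorProduct.neg_tmul]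

theorem sNegPush_tmul_single (n : G.N) (s : G.SmoothSimplex l q) :
    G.sNegPush l q (n ⊗ₜ Finsupp.single s 1) = -(n ⊗ₜ Finsupp.single s.neg 1) := by
  change (-n) ⊗ₜ Finsupp.mapDomain SmoothSimplex.neg (Finsupp.single s 1) = _
  rw [Finsupp.mapDomain_single, TensorProduct.neg_tmul]

theorem linearCombination_sBoundary {M : Type*} [AddCommGroup M] (f : G.SmoothSimplex l 1 → M)
    (z : G.SChain l 2) :
    Finsupp.linearCombination ℤ f (G.sBoundary l 1 z) = Finsupp.linearCombination ℤ
      (fun s => f (s.face 0) - f (s.face 1) + f (s.face 2)) z := by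
  suffices h : Finsupp.linearCombination ℤ f ∘ₗ G.sBoundary l 1 = Finsupp.linearCombination ℤ
      fun s => f (s.face 0) - f (s.face 1) + f (s.face 2) from LinearMap.congr_fun h z
  refine Finsupp.lhom_ext' fun s => LinearMap.ext_ring ?_
  simp [sBoundary_single, Fin.sum_univ_three, sub_eq_add_neg]

theorem theta_tmul_simplex (n : G.N) (u : Fin 3 → G.NR) :
    G.theta (n ⊗ₜ Finsupp.single (G.simplex u) 1) =
      wedgeBilin (G.incl G.R n) (u 1 - u 0) (u 2 - u 0) := by
  change Finsupp.linearCombination ℤ G.thetaSimplex (Finsupp.single _ 1) n = _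
  rw [Finsupp.linearCombination_single, one_smul]
  rfl

variable [Finite E]

theorem sThetaSimplex_eq_wedgeBivector (s : G.SmoothSimplex l 2) (n : G.N) :
    G.sThetaSimplex l s n =
      (2 : ℝ) • wedgeBivector (G.basisNExt ℝ) (G.incl ℝ n) (Matrix.of (G.integral₂ l s)) := by
  refine congrArg (fun w : G.WedgeReal => (2 : ℝ) • w) (Finset.sum_congr rfl fun I _ => ?_)
  simp only [basisNExt_repr, incl_apply, basisNExt_eq_incl, wedgeBasis, Matrix.of_apply]

theorem sTheta_tmul (n : G.N) (z : G.SChain l 2) :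
    G.sTheta l (n ⊗ₜ z) = (2 : ℝ) • wedgeBivector (G.basisNExt ℝ) (G.incl ℝ n)
      (Finsupp.linearCombination ℤ (fun s => Matrix.of (G.integral₂ l s)) z) := by
  induction z using Finsupp.induction_linear with
  | zero => simp
  | add x y hx hy => rw [TensorProduct.tmul_add, map_add, hx, hy, map_add, map_add, smul_add]
  | single s m =>
    change Finsupp.linearCombination ℤ (G.sThetaSimplex l) (Finsupp.single s m) n = _
    rw [Finsupp.linearCombination_single, Finsupp.linearCombination_single, LinearMap.smul_apply,
      sThetaSimplex_eq_wedgeBivector, map_zsmul, smul_comm]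

end Chains

/-! ### Lifts of smooth simplices -/

section FacePoints

/-- The map `ℝ^{q+1} → ℝ^{q+2}` that restricts to the inclusion `Δ^q → Δ^{q+1}` of the face
opposite to the `i`-th vertex. -/
abbrev faceMap {q : ℕ} (i : Fin (q + 2)) : (Fin (q + 1) → ℝ) →ₗ[ℝ] (Fin (q + 2) → ℝ) :=
  FunOnFinite.linearMap ℝ ℝ i.succAbove

/-- The point of `Δ¹` with parameter `t`. -/
def edgePoint (t : ℝ) : Fin 2 → ℝ := ![1 - t, t]

/-- The point of `Δ²` with parameters `p`, as in the definition of `integral₂`. -/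
def trianglePoint (p : ℝ × ℝ) : Fin 3 → ℝ := ![1 - p.1 - p.2, p.1, p.2]

theorem two_succAbove_zero : (2 : Fin 3).succAbove 0 = 0 := rfl

theorem two_succAbove_one : (2 : Fin 3).succAbove 1 = 1 := rfl

theorem edgePoint_mem {t : ℝ} (ht : t ∈ Set.Icc (0 : ℝ) 1) :
    edgePoint t ∈ stdSimplex ℝ (Fin 2) := by
  refine ⟨Fin.forall_fin_two.2 ⟨sub_nonneg.2 ht.2, ht.1⟩, ?_⟩
  simp [edgePoint]

@[simp]
theorem edgePoint_zero : edgePoint 0 = Pi.single 0 1 := by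
  ext i
  fin_cases i <;> simp [edgePoint]

@[simp]
theorem edgePoint_one : edgePoint 1 = Pi.single 1 1 := by
  ext i
  fin_cases i <;> simp [edgePoint]

theorem contDiff_edgePoint : ContDiff ℝ ∞ edgePoint := by
  refine contDiff_pi.2 (Fin.forall_fin_two.2 ⟨?_, ?_⟩)
  exacts [contDiff_const.sub contDiff_id, contDiff_id]

theorem contDiff_trianglePoint : ContDiff ℝ ∞ trianglePoint := by
  refine contDiff_pi.2 fun i => ?_
  fin_cases i
  exacts [(contDiff_const.sub contDiff_fst).sub contDiff_snd, contDiff_fst, contDiff_snd]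

theorem faceMap_zero_edgePoint (t : ℝ) : faceMap 0 (edgePoint t) = trianglePoint (1 - t, t) := by
  ext j
  rw [FunOnFinite.linearMap_apply_apply, Finset.sum_filter, Fin.sum_univ_two]
  fin_cases j <;> simp [edgePoint, trianglePoint]

theorem faceMap_one_edgePoint (t : ℝ) : faceMap 1 (edgePoint t) = trianglePoint (0, t) := by
  ext j
  rw [FunOnFinite.linearMap_apply_apply, Finset.sum_filter, Fin.sum_univ_two]
  fin_cases j <;> simp [edgePoint, trianglePoint, Fin.succAbove, Fin.ext_iff]

theorem faceMap_two_edgePoint (t : ℝ) : faceMap 2 (edgePoint t) = trianglePoint (t, 0) := by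
  ext j
  rw [FunOnFinite.linearMap_apply_apply, Finset.sum_filter, Fin.sum_univ_two]
  fin_cases j <;> simp [edgePoint, trianglePoint, Fin.succAbove, Fin.ext_iff]

end FacePoints

section Lifts

variable {G l} {q : ℕ}

namespace SmoothSimplex

/-- The map `f` to `N_ℝ` is a smooth lift of the smooth simplex `s`. -/
structure IsLift (s : G.SmoothSimplex l q) (f : (Fin (q + 1) → ℝ) → G.NReal) : Prop where
  smooth : G.IsSmooth f
  toFun_eq_mk : ∀ t, s.toFun t = QuotientAddGroup.mk (f t.1)

theorem isLift_lift (s : G.SmoothSimplex l q) : s.IsLift s.lift :=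
  ⟨s.smooth.choose_spec.1, s.smooth.choose_spec.2⟩

theorem isLift_affine (u : Fin (q + 1) → G.NReal) :
    (affine l u).IsLift fun t => ∑ i, t i • u i where
  smooth γ := by
    simp only [LinearMap.sum_apply, LinearMap.smul_apply, smul_eq_mul]
    fun_prop
  toFun_eq_mk _ := rfl

theorem IsLift.face {s : G.SmoothSimplex l (q + 1)} {f : (Fin (q + 2) → ℝ) → G.NReal}
    (hf : s.IsLift f) (i : Fin (q + 2)) : (s.face i).IsLift (f ∘ faceMap i) where
  smooth γ := (hf.smooth γ).comp (LinearMap.toContinuousLinearMap (faceMap i)).contDiff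
  toFun_eq_mk _ := hf.toFun_eq_mk _

/-- A chosen lift to `N_ℝ` of the `i`-th vertex of a smooth simplex. It depends only on the vertex,
so that simplices with a common vertex use the same lift. -/
def vertexLift (s : G.SmoothSimplex l q) (i : Fin (q + 1)) : G.NReal :=
  (s.toFun (stdSimplex.vertex i)).out

theorem vertexLift_face (s : G.SmoothSimplex l (q + 1)) (i : Fin (q + 2)) (j : Fin (q + 1)) :
    (s.face i).vertexLift j = s.vertexLift (i.succAbove j) := by
  change (s.toFun (stdSimplex.map i.succAbove _)).out = _
  rw [stdSimplex.map_vertex]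
  rfl

theorem IsLift.sub_vertexLift_mem {s : G.SmoothSimplex l q} {f : (Fin (q + 1) → ℝ) → G.NReal}
    (hf : s.IsLift f) (i : Fin (q + 1)) : f (Pi.single i 1) - s.vertexLift i ∈ G.lattice l.1 := by
  rw [← QuotientAddGroup.eq_zero_iff, QuotientAddGroup.mk_sub, sub_eq_zero, vertexLift,
    QuotientAddGroup.out_eq', hf.toFun_eq_mk]

theorem countable_lattice [Countable E] : (G.lattice l.1 : Set G.NReal).Countable := by
  have : Countable G.H₁ := inferInstanceAs (Countable (LinearMap.ker G.boundary₁))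
  exact Set.countable_range (G.projC l ∘ₗ G.H₁.subtype)

/-- The difference takes values in the countable set `Λ_C`, hence it is constant. -/
theorem IsLift.sub_eq_sub [Countable E] {s : G.SmoothSimplex l q}
    {f g : (Fin (q + 1) → ℝ) → G.NReal} (hf : s.IsLift f) (hg : s.IsLift g)
    {t t' : Fin (q + 1) → ℝ} (ht : t ∈ stdSimplex ℝ (Fin (q + 1)))
    (ht' : t' ∈ stdSimplex ℝ (Fin (q + 1))) : f t - g t = f t' - g t' := by
  ext γ
  have hconn : IsPreconnected ((fun t => (f t - g t) γ) '' stdSimplex ℝ (Fin (q + 1))) :=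
    (convex_stdSimplex ℝ _).isPreconnected.image _
      ((hf.smooth γ).continuous.sub (hg.smooth γ).continuous).continuousOn
  have hsub : (fun t => (f t - g t) γ) '' stdSimplex ℝ (Fin (q + 1)) ⊆
      (fun c : G.NReal => c γ) '' (G.lattice l.1 : Set G.NReal) := by
    rintro _ ⟨t, ht, rfl⟩
    refine ⟨f t - g t, ?_, rfl⟩
    rw [SetLike.mem_coe, ← QuotientAddGroup.eq_zero_iff, QuotientAddGroup.mk_sub, sub_eq_zero]
    exact (hf.toFun_eq_mk ⟨t, ht⟩).symm.trans (hg.toFun_eq_mk ⟨t, ht⟩)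
  exact (countable_lattice.image _).isTotallyDisconnected _ hsub hconn
    (Set.mem_image_of_mem _ ht) (Set.mem_image_of_mem _ ht')

end SmoothSimplex

/-- The integral of `z_γ dz_γ'` along the path in `N_ℝ` given by the restriction of `f` to `Δ¹`. -/
def edgeIntegral (f : (Fin 2 → ℝ) → G.NReal) (γ γ' : G.H₁) : ℝ :=
  lineIntegral (fun t => f (edgePoint t) γ) fun t => f (edgePoint t) γ'

theorem SmoothSimplex.IsLift.edgeIntegral_eq_add [Countable E] {s : G.SmoothSimplex l 1}
    {f g : (Fin 2 → ℝ) → G.NReal} (hf : s.IsLift f) (hg : s.IsLift g) (γ γ' : G.H₁) :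
    edgeIntegral f γ γ' = edgeIntegral g γ γ' + (f (Pi.single 0 1) - g (Pi.single 0 1)) γ *
      (g (Pi.single 1 1) - g (Pi.single 0 1)) γ' := by
  have hcont {f : (Fin 2 → ℝ) → G.NReal} (hf : s.IsLift f) (γ : G.H₁) :
      ContDiff ℝ ∞ fun t => f (edgePoint t) γ := (hf.smooth γ).comp contDiff_edgePoint
  have hconst (γ : G.H₁) (t : ℝ) (ht : t ∈ Set.Icc (0 : ℝ) 1) : f (edgePoint t) γ =
      g (edgePoint t) γ + (f (Pi.single 0 1) - g (Pi.single 0 1)) γ := by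
    rw [← hf.sub_eq_sub hg (edgePoint_mem ht) (single_mem_stdSimplex ℝ 0), LinearMap.sub_apply,
      add_sub_cancel]
  rw [edgeIntegral, lineIntegral_add_const (hcont hg γ).continuous
    ((hcont hf γ').differentiable (by simp)) ((hcont hg γ').of_le (by simp)) (hconst γ) (hconst γ'),
    edgePoint_zero, edgePoint_one]
  rfl

end Lifts

section Integrals

variable {G l} [Finite E]

open SmoothSimplex

theorem integral₂_eq_edgeIntegral {s : G.SmoothSimplex l 2} {f : (Fin 3 → ℝ) → G.NReal}
    (hf : s.IsLift f) (i j : Fin G.genus) :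
    G.integral₂ l s i j =
      edgeIntegral (f ∘ faceMap 0) (G.cycleBasis i) (G.cycleBasis j)
        - edgeIntegral (f ∘ faceMap 1) (G.cycleBasis i) (G.cycleBasis j)
        + edgeIntegral (f ∘ faceMap 2) (G.cycleBasis i) (G.cycleBasis j) := by
  have hcont (γ : G.H₁) : ContDiff ℝ ∞ fun p => s.lift (trianglePoint p) γ :=
    (s.isLift_lift.smooth γ).comp contDiff_trianglePoint
  have hgreen : G.integral₂ l s i j =
      edgeIntegral (s.lift ∘ faceMap 0) (G.cycleBasis i) (G.cycleBasis j)
        - edgeIntegral (s.lift ∘ faceMap 1) (G.cycleBasis i) (G.cycleBasis j)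
        + edgeIntegral (s.lift ∘ faceMap 2) (G.cycleBasis i) (G.cycleBasis j) := by
    simp only [edgeIntegral, Function.comp_apply, faceMap_zero_edgePoint, faceMap_one_edgePoint,
      faceMap_two_edgePoint]
    exact setIntegral_triangle_fderiv_wedge ((hcont _).of_le (by norm_cast))
      ((hcont _).of_le (by norm_cast))
  obtain ⟨d, hd⟩ : ∃ d, ∀ k, f (Pi.single k 1) - s.lift (Pi.single k 1) = d :=
    ⟨_, fun k => hf.sub_eq_sub s.isLift_lift (single_mem_stdSimplex ℝ k)
      (single_mem_stdSimplex ℝ 0)⟩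
  rw [hgreen, (hf.face 0).edgeIntegral_eq_add (s.isLift_lift.face 0),
    (hf.face 1).edgeIntegral_eq_add (s.isLift_lift.face 1),
    (hf.face 2).edgeIntegral_eq_add (s.isLift_lift.face 2)]
  simp only [Function.comp_apply, FunOnFinite.linearMap_piSingle, hd, LinearMap.sub_apply,
    Fin.zero_succAbove, Fin.one_succAbove_zero, Fin.one_succAbove_one, two_succAbove_zero,
    two_succAbove_one, Fin.succ_zero_eq_one, Fin.succ_one_eq_two]
  ring

end Integrals

/-! ### Periods of smooth edges -/

section EdgePeriods

open SmoothSimplex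

/-- The length pairing is positive definite. -/
theorem projC_subtype_injective [Finite E] :
    Function.Injective (G.projC l ∘ₗ G.H₁.subtype) := by
  refine (injective_iff_map_eq_zero _).2 fun γ hγ => Subtype.ext (Finsupp.ext fun e => ?_)
  have := Fintype.ofFinite E
  have hnorm : G.projC l γ γ = 0 := LinearMap.congr_fun hγ γ
  rw [projC, proj_apply_eq_sum, Finset.sum_eq_zero_iff_of_nonneg
    fun e _ => mul_nonneg (mul_self_nonneg _) (l.2 e).le] at hnorm
  have he := hnorm e (Finset.mem_univ e)
  simp only [mul_eq_zero, (l.2 e).ne', or_self, or_false, Int.cast_eq_zero] at he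
  exact he

variable {G l}

namespace SmoothSimplex

theorem exists_projC_eq_lift_sub_lift (s : G.SmoothSimplex l 1) :
    ∃ γ : G.H₁, G.projC l γ = (s.lift (Pi.single 1 1) - s.vertexLift 1) -
      (s.lift (Pi.single 0 1) - s.vertexLift 0) :=
  sub_mem (s.isLift_lift.sub_vertexLift_mem 1) (s.isLift_lift.sub_vertexLift_mem 0)

/-- The cycle `γ` such that `π_C(γ) ∈ Λ_C` is the displacement of the smooth edge `s` from the
chosen lift of its first vertex to the chosen lift of its second vertex. -/
def edgePeriod (s : G.SmoothSimplex l 1) : G.H₁ := s.exists_projC_eq_lift_sub_lift.choose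

variable [Finite E]

theorem IsLift.projC_edgePeriod {s : G.SmoothSimplex l 1} {f : (Fin 2 → ℝ) → G.NReal}
    (hf : s.IsLift f) : G.projC l s.edgePeriod = (f (Pi.single 1 1) - s.vertexLift 1) -
      (f (Pi.single 0 1) - s.vertexLift 0) := by
  rw [edgePeriod, s.exists_projC_eq_lift_sub_lift.choose_spec, sub_sub_sub_comm,
    sub_sub_sub_comm (f _), sub_left_inj, sub_eq_sub_iff_sub_eq_sub]
  exact s.isLift_lift.sub_eq_sub hf (single_mem_stdSimplex ℝ 1) (single_mem_stdSimplex ℝ 0)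

theorem projC_edgePeriod_face (s : G.SmoothSimplex l 2) (k : Fin 3) :
    G.projC l (s.face k).edgePeriod =
      (s.lift (Pi.single (k.succAbove 1) 1) - s.vertexLift (k.succAbove 1)) -
        (s.lift (Pi.single (k.succAbove 0) 1) - s.vertexLift (k.succAbove 0)) := by
  rw [(s.isLift_lift.face k).projC_edgePeriod, vertexLift_face, vertexLift_face,
    Function.comp_apply, Function.comp_apply, FunOnFinite.linearMap_piSingle,
    FunOnFinite.linearMap_piSingle]

theorem edgePeriod_face_one (s : G.SmoothSimplex l 2) :
    (s.face 1).edgePeriod = (s.face 0).edgePeriod + (s.face 2).edgePeriod := by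
  apply G.projC_subtype_injective l
  change G.projC l _ = G.projC l (((s.face 0).edgePeriod : E →₀ ℤ) + (s.face 2).edgePeriod)
  rw [map_add, projC_edgePeriod_face, projC_edgePeriod_face]
  refine (s.projC_edgePeriod_face 1).trans ?_
  exact (sub_add_sub_cancel _ _ _).symm

/-- The integral of `z_γ dz_γ'` along a lift of the smooth edge `s` that starts at the chosen lift
of its first vertex, corrected by a product of periods so as to make
`integral₂_eq_edgeCochain_add` hold. -/
def edgeCochain (s : G.SmoothSimplex l 1) (γ γ' : G.H₁) : ℝ :=
  edgeIntegral s.lift γ γ' + (s.vertexLift 0 - s.lift (Pi.single 0 1)) γ *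
    (s.lift (Pi.single 1 1) - s.lift (Pi.single 0 1)) γ' -
      G.projC l s.edgePeriod γ * s.vertexLift 1 γ'

theorem IsLift.edgeIntegral_eq_edgeCochain_add {s : G.SmoothSimplex l 1}
    {f : (Fin 2 → ℝ) → G.NReal} (hf : s.IsLift f) (γ γ' : G.H₁) :
    edgeIntegral f γ γ' = s.edgeCochain γ γ' + (f (Pi.single 0 1) - s.vertexLift 0) γ *
      (f (Pi.single 1 1) - f (Pi.single 0 1)) γ' +
        G.projC l s.edgePeriod γ * s.vertexLift 1 γ' := by
  have h := LinearMap.congr_fun (hf.sub_eq_sub s.isLift_lift (single_mem_stdSimplex ℝ 1)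
    (single_mem_stdSimplex ℝ 0)) γ'
  rw [hf.edgeIntegral_eq_add s.isLift_lift, edgeCochain]
  simp only [LinearMap.sub_apply] at h ⊢
  linear_combination (s.vertexLift 0 γ - f (Pi.single 0 1) γ) * h

end SmoothSimplex

variable [Finite E]

/-- Modulo coboundaries, the cocycle `∫ dz_i ∧ dz_j` is the cup product of the period cocycles of
`dz_i` and `dz_j`. -/
theorem integral₂_eq_edgeCochain_add (s : G.SmoothSimplex l 2) (i j : Fin G.genus) :
    G.integral₂ l s i j =
      (s.face 0).edgeCochain (G.cycleBasis i) (G.cycleBasis j)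
        - (s.face 1).edgeCochain (G.cycleBasis i) (G.cycleBasis j)
        + (s.face 2).edgeCochain (G.cycleBasis i) (G.cycleBasis j)
        + G.projC l (s.face 2).edgePeriod (G.cycleBasis i) *
          G.projC l (s.face 0).edgePeriod (G.cycleBasis j) := by
  rw [integral₂_eq_edgeIntegral s.isLift_lift,
    (s.isLift_lift.face 0).edgeIntegral_eq_edgeCochain_add,
    (s.isLift_lift.face 1).edgeIntegral_eq_edgeCochain_add,
    (s.isLift_lift.face 2).edgeIntegral_eq_edgeCochain_add]
  simp only [projC_edgePeriod_face, vertexLift_face, Function.comp_apply,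
    FunOnFinite.linearMap_piSingle, LinearMap.sub_apply, Fin.zero_succAbove,
    Fin.one_succAbove_zero, Fin.one_succAbove_one, two_succAbove_zero, two_succAbove_one,
    Fin.succ_zero_eq_one, Fin.succ_one_eq_two]
  ring

end EdgePeriods

/-! ### Affine simplices -/

section Affine

open SmoothSimplex

variable {G l} {q : ℕ}

theorem affine_add_const (u : Fin (q + 1) → G.NReal) {c : G.NReal} (hc : c ∈ G.lattice l.1) :
    affine l (fun i => u i + c) = affine l u := by
  ext t
  refine (QuotientAddGroup.eq.2 ?_).symm
  have hsum : ∑ i, t.1 i • (u i + c) = ∑ i, t.1 i • u i + c := by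
    rw [← one_smul ℝ c, ← t.2.2, Finset.sum_smul, ← Finset.sum_add_distrib]
    simp only [smul_add, ← Finset.sum_smul, t.2.2, one_smul]
  rwa [hsum, neg_add_cancel_left]

theorem sum_smul_comp_faceMap (u : Fin (q + 2) → G.NReal) (i : Fin (q + 2)) :
    (fun t => ∑ k, t k • u k) ∘ faceMap i = fun t => ∑ j, t j • u (i.succAbove j) := by
  ext1 t
  simp only [Function.comp_apply, FunOnFinite.linearMap_apply_apply, Finset.sum_smul]
  rw [← Finset.sum_fiberwise Finset.univ i.succAbove]
  refine Finset.sum_congr rfl fun k _ => Finset.sum_congr rfl fun j hj => ?_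
  rw [(Finset.mem_filter.1 hj).2]

theorem face_affine (u : Fin (q + 2) → G.NReal) (i : Fin (q + 2)) :
    (affine l u).face i = affine l (u ∘ i.succAbove) := by
  ext t
  exact congrArg QuotientAddGroup.mk (congrFun (sum_smul_comp_faceMap u i) t.1)

theorem neg_affine (u : Fin (q + 1) → G.NReal) : (affine l u).neg = affine l (-u) := by
  ext t
  refine congrArg (QuotientAddGroup.mk (s := G.lattice l.1)) ?_
  simp only [Pi.neg_apply, smul_neg, Finset.sum_neg_distrib]

theorem edgeIntegral_affine (u : Fin 2 → G.NReal) (γ γ' : G.H₁) :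
    edgeIntegral (fun t => ∑ i, t i • u i) γ γ' =
      2⁻¹ * (u 0 γ + u 1 γ) * (u 1 γ' - u 0 γ') := by
  have hcoord (t : ℝ) (γ : G.H₁) :
      (∑ i, edgePoint t i • u i) γ = u 0 γ + t * (u 1 γ - u 0 γ) := by
    simp only [Fin.sum_univ_two, edgePoint, LinearMap.add_apply, LinearMap.smul_apply, smul_eq_mul,
      Matrix.cons_val_zero, Matrix.cons_val_one]
    ring
  have hderiv (t : ℝ) : deriv (fun t => u 0 γ' + t * (u 1 γ' - u 0 γ')) t = u 1 γ' - u 0 γ' := by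
    simp
  simp only [edgeIntegral, lineIntegral, hcoord, hderiv]
  rw [intervalIntegral.integral_mul_const, intervalIntegral.integral_add
    intervalIntegrable_const ((by fun_prop : Continuous _).intervalIntegrable _ _),
    intervalIntegral.integral_const, intervalIntegral.integral_mul_const, integral_id, smul_eq_mul]
  ring

variable [Finite E]

theorem integral₂_affine (u : Fin 3 → G.NReal) (i j : Fin G.genus) :
    G.integral₂ l (affine l u) i j =
      2⁻¹ * ((u 1 - u 0) (G.cycleBasis i) * (u 2 - u 0) (G.cycleBasis j)
        - (u 1 - u 0) (G.cycleBasis j) * (u 2 - u 0) (G.cycleBasis i)) := by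
  rw [integral₂_eq_edgeIntegral (isLift_affine u)]
  simp only [sum_smul_comp_faceMap, edgeIntegral_affine, LinearMap.sub_apply, Fin.zero_succAbove,
    Fin.one_succAbove_zero, Fin.one_succAbove_one, two_succAbove_zero, two_succAbove_one,
    Fin.succ_zero_eq_one, Fin.succ_one_eq_two]
  ring

theorem sThetaSimplex_affine (u : Fin 3 → G.NReal) (n : G.N) :
    G.sThetaSimplex l (affine l u) n = wedgeBilin (G.incl ℝ n) (u 1 - u 0) (u 2 - u 0) := by
  rw [sThetaSimplex_eq_wedgeBivector, wedgeBilin_eq_wedgeBivector (G.basisNExt ℝ), ← map_smul]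
  congr 1
  ext i j
  simp only [Matrix.smul_apply, Matrix.of_apply, integral₂_affine, basisNExt_repr, smul_eq_mul]
  ring

end Affine

/-! ### Specialization of the universal chains -/

section Specialization

variable {q : ℕ}

/-- The evaluation homomorphism `R → ℝ`, `x_e ↦ ℓ(e)`. -/
abbrev evalLength : G.R →+* ℝ := (MvPolynomial.aeval l.1 : G.R →ₐ[ℤ] ℝ).toRingHom

theorem evalLength_comp_X : G.evalLength l ∘ MvPolynomial.X = l.1 := by
  ext e
  simp

theorem mapNExt_projU (c : E →₀ ℤ) :
    G.mapNExt (G.evalLength l) (G.projU c) = G.projC l c := by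
  rw [mapNExt_proj, evalLength_comp_X]

/-- The specialization of a simplex of the universal Jacobian at `ℓ`: the affine simplex of `Jac(C)`
with the specialized vertices. -/
def specializeSimplex : G.Simplex q → G.SmoothSimplex l q :=
  Quotient.lift (s := G.simplexSetoid q)
    (fun u => SmoothSimplex.affine l (G.mapNExt (G.evalLength l) ∘ u)) (by
      rintro u u' ⟨_, ⟨γ, rfl⟩, h⟩
      rw [← affine_add_const _ (c := G.projC l γ) ⟨γ, rfl⟩]
      congr 1
      ext1 i
      rw [Function.comp_apply, Function.comp_apply, h i, map_add, ← mapNExt_projU]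
      rfl)

theorem specializeSimplex_simplex (u : Fin (q + 1) → G.NR) :
    G.specializeSimplex l (G.simplex u) =
      SmoothSimplex.affine l (G.mapNExt (G.evalLength l) ∘ u) := rfl

theorem specializeSimplex_face (i : Fin (q + 2)) (s : G.Simplex (q + 1)) :
    G.specializeSimplex l (G.face i s) = (G.specializeSimplex l s).face i := by
  induction s using Quotient.inductionOn with
  | h u => exact (face_affine (G.mapNExt (G.evalLength l) ∘ u) i).symm

theorem specializeSimplex_negSimplex (s : G.Simplex q) :
    G.specializeSimplex l (G.negSimplex s) = (G.specializeSimplex l s).neg := by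
  induction s using Quotient.inductionOn with
  | h u =>
    refine (congrArg (SmoothSimplex.affine l) ?_).trans (neg_affine _).symm
    exact funext fun i => map_neg _ _

variable (q) in
/-- Specialization of the universal chains at `ℓ`. -/
def specialize : G.TChain q →ₗ[ℤ] G.STChain l q :=
  LinearMap.lTensor G.N (Finsupp.lmapDomain ℤ ℤ (G.specializeSimplex l))

theorem specialize_tmul_single (n : G.N) (s : G.Simplex q) :
    G.specialize l q (n ⊗ₜ Finsupp.single s 1) =
      n ⊗ₜ Finsupp.single (G.specializeSimplex l s) 1 := by
  change n ⊗ₜ Finsupp.mapDomain (G.specializeSimplex l) (Finsupp.single s 1) = _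
  rw [Finsupp.mapDomain_single]

theorem stBoundary_specialize (c : G.TChain (q + 1)) :
    G.stBoundary l q (G.specialize l (q + 1) c) = G.specialize l q (G.tBoundary q c) := by
  suffices h : G.stBoundary l q ∘ₗ G.specialize l (q + 1) = G.specialize l q ∘ₗ G.tBoundary q from
    LinearMap.congr_fun h c
  refine tensor_finsupp_hom_ext fun n s => ?_
  rw [LinearMap.comp_apply, LinearMap.comp_apply, specialize_tmul_single, stBoundary_tmul,
    tBoundary_tmul, sBoundary_single, boundary_single, TensorProduct.tmul_sum,
    TensorProduct.tmul_sum, map_sum]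
  refine Finset.sum_congr rfl fun i _ => ?_
  rw [TensorProduct.tmul_smul, TensorProduct.tmul_smul, map_smul, specialize_tmul_single,
    specializeSimplex_face]

theorem sNegPush_specialize (c : G.TChain q) :
    G.sNegPush l q (G.specialize l q c) = G.specialize l q (G.negPush q c) := by
  suffices h : G.sNegPush l q ∘ₗ G.specialize l q = G.specialize l q ∘ₗ G.negPush q from
    LinearMap.congr_fun h c
  refine tensor_finsupp_hom_ext fun n s => ?_
  rw [LinearMap.comp_apply, LinearMap.comp_apply, specialize_tmul_single, sNegPush_tmul_single,
    negPush_tmul_single, map_neg, specialize_tmul_single, specializeSimplex_negSimplex]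

theorem specialize_abelJacobiEdge (a : V) (e : E) :
    G.specialize l 1 (G.abelJacobiEdge a e) = G.sAbelJacobiEdge l (CurvePoint.vertex a) e := by
  rw [abelJacobiEdge, specialize_tmul_single, specializeSimplex_simplex, sAbelJacobiEdge]
  congr 3
  refine funext (Fin.forall_fin_two.2 ⟨?_, ?_⟩) <;>
  · refine (G.mapNExt_projU l _).trans ?_
    simp [abelJacobiLift, CurvePoint.offset, CurvePoint.root]

theorem specialize_ceresaCycle [Fintype E] (a : V) :
    G.specialize l 1 (G.ceresaCycle a) = G.tropicalCeresaCycle l (CurvePoint.vertex a) := by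
  simp only [ceresaCycle, tropicalCeresaCycle, map_sub, ← sNegPush_specialize, map_sum,
    specialize_abelJacobiEdge]

variable [Finite E]

theorem sTheta_tmul_single (n : G.N) (s : G.SmoothSimplex l 2) :
    G.sTheta l (n ⊗ₜ Finsupp.single s 1) = G.sThetaSimplex l s n := by
  change Finsupp.linearCombination ℤ (G.sThetaSimplex l) (Finsupp.single s 1) n = _
  rw [Finsupp.linearCombination_single, one_smul]

theorem sTheta_specialize (c : G.TChain 2) :
    G.sTheta l (G.specialize l 2 c) = G.mapWedge (G.evalLength l) (G.theta c) := by
  suffices h : G.sTheta l ∘ₗ G.specialize l 2 = G.mapWedge (G.evalLength l) ∘ₗ G.theta from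
    LinearMap.congr_fun h c
  refine tensor_finsupp_hom_ext fun n s => ?_
  rw [LinearMap.comp_apply, LinearMap.comp_apply, specialize_tmul_single, sTheta_tmul_single]
  induction s using Quotient.inductionOn with
  | h u =>
    refine (sThetaSimplex_affine _ n).trans
      (.trans ?_ (congrArg _ (G.theta_tmul_simplex n u).symm))
    rw [mapWedge_wedgeBilin, mapNExt_incl]
    exact congrArg₂ (fun p q => wedgeBilin (G.incl ℝ n) p q) (map_sub _ _ _).symm
      (map_sub _ _ _).symm

theorem mapWedge_mem_tropicalPeriods {w : G.WedgeR} (hw : w ∈ G.periods) :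
    G.mapWedge (G.evalLength l) w ∈ G.tropicalPeriods l := by
  obtain ⟨c, hc, rfl⟩ := hw
  refine ⟨G.specialize l 2 c, ?_, G.sTheta_specialize l c⟩
  change G.stBoundary l 1 _ = 0
  rw [stBoundary_specialize, show G.tBoundary 1 c = 0 from hc, map_zero]

end Specialization

/-! ### Periods -/

section Periods

section LatticeWedge

variable {A B : Type*} [CommRing A] [CommRing B]

/-- The map `γ ⊗ γ' ↦ n ∧ π(γ) ∧ π(γ')`. -/
def latticeWedge (x : E → A) (n : G.N) : G.H₁ ⊗[ℤ] G.H₁ →ₗ[ℤ] ⋀[A]^3 (G.NExt A) :=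
  TensorProduct.lift (((wedgeBilin (G.incl A n)).restrictScalars₁₂ ℤ ℤ).compl₁₂
    (G.proj x ∘ₗ G.H₁.subtype) (G.proj x ∘ₗ G.H₁.subtype))

theorem latticeWedge_tmul (x : E → A) (n : G.N) (γ γ' : G.H₁) :
    G.latticeWedge x n (γ ⊗ₜ γ') = wedgeBilin (G.incl A n) (G.proj x γ) (G.proj x γ') := rfl

theorem mapWedge_latticeWedge [Finite E] (φ : A →+* B) (x : E → A) (n : G.N)
    (c : G.H₁ ⊗[ℤ] G.H₁) :
    G.mapWedge φ (G.latticeWedge x n c) = G.latticeWedge (φ ∘ x) n c := by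
  induction c with
  | zero => simp only [map_zero]
  | add c c' hc hc' => simp only [map_add, hc, hc']
  | tmul γ γ' =>
    rw [latticeWedge_tmul, latticeWedge_tmul, mapWedge_wedgeBilin, mapNExt_incl, mapNExt_proj,
      mapNExt_proj]

end LatticeWedge

theorem simplex_eq_of_translate {q : ℕ} {u u' : Fin (q + 1) → G.NR} {c : G.NR}
    (hc : c ∈ G.latticeU) (h : ∀ i, u' i = u i + c) : G.simplex u = G.simplex u' :=
  Quotient.sound ⟨c, hc, h⟩

theorem boundary_simplex_add (γ : G.H₁) (q : G.NR) :
    G.boundary 1 (Finsupp.single (G.simplex ![0, G.projU γ, G.projU γ + q]) 1) =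
      Finsupp.single (G.simplex ![0, q]) 1 - Finsupp.single (G.simplex ![0, G.projU γ + q]) 1 +
        Finsupp.single (G.simplex ![0, G.projU γ]) 1 := by
  have h₀ : G.face 0 (G.simplex ![0, G.projU γ, G.projU γ + q]) = G.simplex ![0, q] :=
    (G.simplex_eq_of_translate ⟨γ, rfl⟩ fun i => by fin_cases i <;> simp [add_comm]).symm
  have h₁ : G.face 1 (G.simplex ![0, G.projU γ, G.projU γ + q]) = G.simplex ![0, G.projU γ + q] :=
    congrArg G.simplex (funext (Fin.forall_fin_two.2 ⟨rfl, rfl⟩))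
  have h₂ : G.face 2 (G.simplex ![0, G.projU γ, G.projU γ + q]) = G.simplex ![0, G.projU γ] :=
    congrArg G.simplex (funext (Fin.forall_fin_two.2 ⟨rfl, rfl⟩))
  rw [boundary_single, Fin.sum_univ_three, h₀, h₁, h₂]
  simp [sub_eq_add_neg]

/-- The two triangles `(0, p, p + q)` and `(0, q, p + q)` with `p = π(γ)` and `q = π(γ')` glue to
the torus swept out by `γ` and `γ'`. -/
def torusChain (γ γ' : G.H₁) : G.Chain 2 :=
  Finsupp.single (G.simplex ![0, G.projU γ, G.projU γ + G.projU γ']) 1 -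
    Finsupp.single (G.simplex ![0, G.projU γ', G.projU γ' + G.projU γ]) 1

theorem boundary_torusChain (γ γ' : G.H₁) : G.boundary 1 (G.torusChain γ γ') = 0 := by
  rw [torusChain, map_sub, boundary_simplex_add, boundary_simplex_add,
    add_comm (G.projU γ')]
  abel

theorem theta_tmul_torusChain (n : G.N) (γ γ' : G.H₁) :
    G.theta (n ⊗ₜ G.torusChain γ γ') =
      G.latticeWedge MvPolynomial.X n (γ ⊗ₜ γ' - γ' ⊗ₜ γ) := by
  rw [torusChain, TensorProduct.tmul_sub, map_sub, theta_tmul_simplex, theta_tmul_simplex,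
    (G.latticeWedge _ n).map_sub, latticeWedge_tmul, latticeWedge_tmul]
  simp [isAlt_wedgeBilin (G.incl G.R n) _]

theorem latticeWedge_mem_periods [Finite E] (n : G.N) {c : G.H₁ ⊗[ℤ] G.H₁}
    (hc : TensorProduct.comm ℤ G.H₁ G.H₁ c = -c) :
    G.latticeWedge MvPolynomial.X n c ∈ G.periods := by
  suffices h : Submodule.span ℤ (Set.range fun γ : G.H₁ × G.H₁ => γ.1 ⊗ₜ[ℤ] γ.2 - γ.2 ⊗ₜ[ℤ] γ.1) ≤
      ((LinearMap.ker (G.tBoundary 1)).map G.theta).comap (G.latticeWedge MvPolynomial.X n) from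
    h (mem_span_tmul_sub_tmul_of_comm_eq_neg G.cycleBasis hc)
  rw [Submodule.span_le]
  rintro _ ⟨⟨γ, γ'⟩, rfl⟩
  refine ⟨n ⊗ₜ G.torusChain γ γ', ?_, G.theta_tmul_torusChain n γ γ'⟩
  change G.tBoundary 1 (n ⊗ₜ G.torusChain γ γ') = 0
  rw [tBoundary_tmul, boundary_torusChain, TensorProduct.tmul_zero]

variable [Finite E]

/-- The bilinear form `γ ⊗ γ' ↦ dz_i(γ) dz_j(γ')`. -/
def periodMatrix : G.H₁ ⊗[ℤ] G.H₁ →ₗ[ℤ] Matrix (Fin G.genus) (Fin G.genus) ℝ :=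
  TensorProduct.lift (LinearMap.mk₂ ℤ
    (fun γ γ' => Matrix.of fun i j =>
      G.projC l γ (G.cycleBasis i) * G.projC l γ' (G.cycleBasis j))
    (fun _ _ _ => by ext; simp [add_mul]) (fun _ _ _ => by ext; simp [mul_assoc])
    (fun _ _ _ => by ext; simp [mul_add]) (fun _ _ _ => by ext; simp [mul_left_comm]))

theorem periodMatrix_tmul (γ γ' : G.H₁) :
    G.periodMatrix l (γ ⊗ₜ γ') =
      Matrix.of fun i j => G.projC l γ (G.cycleBasis i) * G.projC l γ' (G.cycleBasis j) := rfl

theorem periodMatrix_comm (c : G.H₁ ⊗[ℤ] G.H₁) :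
    G.periodMatrix l (TensorProduct.comm ℤ _ _ c) = (G.periodMatrix l c).transpose := by
  induction c with
  | zero => simp
  | add c c' hc hc' => simp [hc, hc']
  | tmul γ γ' =>
    ext i j
    exact mul_comm _ _

theorem latticeWedge_eq_wedgeBivector (n : G.N) (c : G.H₁ ⊗[ℤ] G.H₁) :
    G.latticeWedge l.1 n c = wedgeBivector (G.basisNExt ℝ) (G.incl ℝ n)
      (G.periodMatrix l c - (G.periodMatrix l c).transpose) := by
  induction c with
  | zero => simp
  | add c c' hc hc' =>
    rw [(G.latticeWedge l.1 n).map_add, hc, hc', (G.periodMatrix l).map_add, Matrix.transpose_add,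
      add_sub_add_comm, map_add]
  | tmul γ γ' =>
    rw [latticeWedge_tmul, wedgeBilin_eq_wedgeBivector (G.basisNExt ℝ), periodMatrix_tmul]
    rfl

variable {G l}

/-- The second homology class of a smooth two-chain in the torus `Jac(C)`, as an element of
`H₁ ⊗ H₁`, computed by the Alexander–Whitney formula. -/
def cupClass : G.SChain l 2 →ₗ[ℤ] G.H₁ ⊗[ℤ] G.H₁ :=
  Finsupp.linearCombination ℤ fun s => (s.face 2).edgePeriod ⊗ₜ (s.face 0).edgePeriod

theorem comm_cupClass (z : G.SChain l 2) :
    TensorProduct.comm ℤ G.H₁ G.H₁ (cupClass z) = -cupClass z - Finsupp.linearCombination ℤ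
      (fun s => s.edgePeriod ⊗ₜ s.edgePeriod) (G.sBoundary l 1 z) := by
  rw [linearCombination_sBoundary]
  induction z using Finsupp.induction_linear with
  | zero => simp
  | add z z' hz hz' =>
    simp only [map_add, hz, hz']
    abel
  | single s m =>
    simp only [cupClass, Finsupp.linearCombination_single, map_zsmul, ← smul_neg, ← smul_sub,
      SmoothSimplex.edgePeriod_face_one, TensorProduct.add_tmul, TensorProduct.tmul_add,
      TensorProduct.comm_tmul]
    congr 1
    abel

theorem comm_cupClass_of_cycle {z : G.SChain l 2} (hz : G.sBoundary l 1 z = 0) :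
    TensorProduct.comm ℤ G.H₁ G.H₁ (cupClass z) = -cupClass z := by
  rw [comm_cupClass, hz, map_zero, sub_zero]

theorem linearCombination_integral₂ (z : G.SChain l 2) :
    Finsupp.linearCombination ℤ (fun s => Matrix.of (G.integral₂ l s)) z =
      Finsupp.linearCombination ℤ (fun s => Matrix.of fun i j =>
        s.edgeCochain (G.cycleBasis i) (G.cycleBasis j)) (G.sBoundary l 1 z) +
          G.periodMatrix l (cupClass z) := by
  rw [linearCombination_sBoundary]
  induction z using Finsupp.induction_linear with
  | zero => simp
  | add z z' hz hz' =>
    simp only [map_add, hz, hz']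
    abel
  | single s m =>
    simp only [cupClass, Finsupp.linearCombination_single, map_smul, ← smul_add]
    congr 1
    ext i j
    exact integral₂_eq_edgeCochain_add s i j

theorem sTheta_tmul_of_cycle (n : G.N) {z : G.SChain l 2} (hz : G.sBoundary l 1 z = 0) :
    G.sTheta l (n ⊗ₜ z) = G.latticeWedge l.1 n (cupClass z) := by
  have hP : (G.periodMatrix l (cupClass z)).transpose = -G.periodMatrix l (cupClass z) := by
    rw [← periodMatrix_comm, comm_cupClass_of_cycle hz, map_neg]
  rw [sTheta_tmul, linearCombination_integral₂, hz, map_zero, zero_add,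
    latticeWedge_eq_wedgeBivector, hP, sub_neg_eq_add, ← two_smul ℝ, map_smul]

theorem exists_mapWedge_eq_sTheta_tmul (n : G.N) {z : G.SChain l 2} (hz : G.sBoundary l 1 z = 0) :
    ∃ w ∈ G.periods, G.mapWedge (G.evalLength l) w = G.sTheta l (n ⊗ₜ z) := by
  refine ⟨_, G.latticeWedge_mem_periods n (comm_cupClass_of_cycle hz), ?_⟩
  rw [mapWedge_latticeWedge, evalLength_comp_X, sTheta_tmul_of_cycle n hz]

variable (G l) in
theorem mem_tropicalPeriods_iff (w : G.WedgeReal) :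
    w ∈ G.tropicalPeriods l ↔ ∃ w' ∈ G.periods, G.mapWedge (G.evalLength l) w' = w := by
  constructor
  · rintro ⟨c, hc, rfl⟩
    have hz (i) : G.sBoundary l 1 (dualTensorHom ℤ G.H₁ (G.SChain l 2) c (G.cycleBasis i)) = 0 := by
      have h := LinearMap.congr_fun (LinearMap.congr_fun
        (dualTensorHom_comp_lTensor (R := ℤ) (M := G.H₁) (G.sBoundary l 1)) c) (G.cycleBasis i)
      refine h.symm.trans ?_
      change dualTensorHom ℤ G.H₁ (G.SChain l 1) (G.stBoundary l 1 c) (G.cycleBasis i) = 0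
      rw [show G.stBoundary l 1 c = 0 from hc, map_zero, LinearMap.zero_apply]
    choose w hw hw' using fun i => exists_mapWedge_eq_sTheta_tmul (G.cocycleBasis i) (hz i)
    refine ⟨∑ i, w i, sum_mem fun i _ => hw i, ?_⟩
    conv_rhs => rw [← sum_coord_tmul_dualTensorHom G.cycleBasis c]
    rw [map_sum, map_sum]
    exact Finset.sum_congr rfl fun i _ => hw' i
  · rintro ⟨w', hw', rfl⟩
    exact G.mapWedge_mem_tropicalPeriods l hw'

end Periods

/-! ### Change of the base point -/

section BasePoint

theorem boundary₁_single (e : E) :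
    G.boundary₁ (Finsupp.single e 1) =
      Finsupp.single (G.head e) 1 - Finsupp.single (G.tail e) 1 := by
  simp [boundary₁]

theorem linearCombination_boundary₁ [Fintype E] {M : Type*} [AddCommGroup M] (h : V → M)
    (c : E →₀ ℤ) :
    Finsupp.linearCombination ℤ h (G.boundary₁ c) = ∑ e, c e • (h (G.head e) - h (G.tail e)) := by
  conv_lhs => rw [← Finsupp.univ_sum_single c]
  rw [map_sum, map_sum]
  refine Finset.sum_congr rfl fun e _ => ?_
  simp [boundary₁]

/-- Evaluated at a cycle `γ`, the sum is the value at `γ` of the coboundary of `h`. -/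
theorem sum_edgeClass_tmul [Fintype E] {M : Type*} [AddCommGroup M] (h : V → M) :
    ∑ e, G.edgeClass e ⊗ₜ[ℤ] (h (G.head e) - h (G.tail e)) = 0 := by
  classical
  refine (dualTensorHomEquivOfBasis G.cycleBasis).injective (LinearMap.ext fun γ => ?_)
  have hγ := G.linearCombination_boundary₁ h γ
  rw [show G.boundary₁ γ = 0 from γ.2, map_zero] at hγ
  rw [map_sum, LinearMap.sum_apply, map_zero, LinearMap.zero_apply, hγ]
  exact Finset.sum_congr rfl fun e _ => rfl

section Paths

variable {G}

theorem IsPath.boundary₁_eq {a b : V} {δ : E →₀ ℤ} (h : G.IsPath a b δ) :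
    G.boundary₁ δ = Finsupp.single b 1 - Finsupp.single a 1 := by
  induction h with
  | nil => simp
  | forward e _ ih => simp [ih, boundary₁_single]
  | backward e _ ih => simp [ih, boundary₁_single]

theorem Connected.exists_isPath (hG : G.Connected) (a b : V) : ∃ δ, G.IsPath a b δ := by
  suffices h : ∀ p q, Relation.EqvGen (fun p q => ∃ e, G.tail e = p ∧ G.head e = q) p q →
      ((∃ δ, G.IsPath a p δ) ↔ ∃ δ, G.IsPath a q δ) from
    (h a b (hG.2 a b)).1 ⟨0, IsPath.nil⟩
  intro p q hpq
  induction hpq with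
  | rel p q h =>
    obtain ⟨e, rfl, rfl⟩ := h
    exact ⟨fun ⟨_, h⟩ => ⟨_, h.forward e⟩, fun ⟨_, h⟩ => ⟨_, h.backward e⟩⟩
  | refl p => exact Iff.rfl
  | symm p q _ ih => exact ih.symm
  | trans p q r _ _ ih ih' => exact ih.trans ih'

theorem Connected.boundary₁_path (hG : G.Connected) (a b : V) :
    G.boundary₁ (G.path a b) = Finsupp.single b 1 - Finsupp.single a 1 := by
  have h := hG.exists_isPath a b
  rw [path, dif_pos h]
  exact h.choose_spec.boundary₁_eq

end Paths

theorem affine_eq_of_eq_add_projC {c : E →₀ ℤ} (hc : G.boundary₁ c = 0) {x y x' y' : G.NReal}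
    (hx : x' = x + G.projC l c) (hy : y' = y + G.projC l c) :
    SmoothSimplex.affine l ![x', y'] = SmoothSimplex.affine l ![x, y] := by
  rw [← affine_add_const ![x, y] (c := G.projC l c) ⟨⟨c, hc⟩, rfl⟩, hx, hy]
  exact congrArg _ (funext (Fin.forall_fin_two.2 ⟨rfl, rfl⟩))

theorem sBoundary_affine (x y z : G.NReal) :
    G.sBoundary l 1 (Finsupp.single (SmoothSimplex.affine l ![x, y, z]) 1) =
      Finsupp.single (SmoothSimplex.affine l ![y, z]) 1 -
        Finsupp.single (SmoothSimplex.affine l ![x, z]) 1 +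
          Finsupp.single (SmoothSimplex.affine l ![x, y]) 1 := by
  have h₀ : ![x, y, z] ∘ Fin.succAbove 0 = ![y, z] := funext (Fin.forall_fin_two.2 ⟨rfl, rfl⟩)
  have h₁ : ![x, y, z] ∘ Fin.succAbove 1 = ![x, z] := funext (Fin.forall_fin_two.2 ⟨rfl, rfl⟩)
  have h₂ : ![x, y, z] ∘ Fin.succAbove 2 = ![x, y] := funext (Fin.forall_fin_two.2 ⟨rfl, rfl⟩)
  rw [sBoundary_single, Fin.sum_univ_three, face_affine, face_affine, face_affine, h₀, h₁, h₂]
  simp [sub_eq_add_neg]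

theorem stBoundary_sNegPush {q : ℕ} (c : G.STChain l (q + 1)) :
    G.stBoundary l q (G.sNegPush l (q + 1) c) = G.sNegPush l q (G.stBoundary l q c) := by
  suffices h : G.stBoundary l q ∘ₗ G.sNegPush l (q + 1) = G.sNegPush l q ∘ₗ G.stBoundary l q from
    LinearMap.congr_fun h c
  refine tensor_finsupp_hom_ext fun n s => ?_
  rw [LinearMap.comp_apply, LinearMap.comp_apply, sNegPush_tmul_single, map_neg, stBoundary_tmul,
    stBoundary_tmul, sBoundary_single, sBoundary_single, TensorProduct.tmul_sum,
    TensorProduct.tmul_sum, map_sum, ← Finset.sum_neg_distrib]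
  refine Finset.sum_congr rfl fun i _ => ?_
  rw [TensorProduct.tmul_smul, TensorProduct.tmul_smul, map_smul, sNegPush_tmul_single, smul_neg]
  rfl

/-- The parallelogram with vertices `x`, `y`, `x + w`, `y + w` and with coefficient `n`, divided
into two triangles. It is used to translate the edge from `x` to `y` by `w`. -/
def prism (n : G.N) (x y w : G.NReal) : G.STChain l 2 :=
  n ⊗ₜ (Finsupp.single (SmoothSimplex.affine l ![x, y, y + w]) 1 -
    Finsupp.single (SmoothSimplex.affine l ![x, x + w, y + w]) 1)

theorem stBoundary_prism (n : G.N) (x y w : G.NReal) :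
    G.stBoundary l 1 (G.prism l n x y w) =
      n ⊗ₜ (Finsupp.single (SmoothSimplex.affine l ![y, y + w]) 1 -
        Finsupp.single (SmoothSimplex.affine l ![x, x + w]) 1) +
      (n ⊗ₜ Finsupp.single (SmoothSimplex.affine l ![x, y]) 1 -
        n ⊗ₜ Finsupp.single (SmoothSimplex.affine l ![x + w, y + w]) 1) := by
  rw [prism, stBoundary_tmul, map_sub, sBoundary_affine, sBoundary_affine,
    ← TensorProduct.tmul_sub, ← TensorProduct.tmul_add]
  congr 1
  abel

theorem sNegPush_prism (n : G.N) (x y w : G.NReal) :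
    G.sNegPush l 2 (G.prism l n x y w) = -G.prism l n (-x) (-y) (-w) := by
  rw [prism, prism, TensorProduct.tmul_sub, TensorProduct.tmul_sub, map_sub, sNegPush_tmul_single,
    sNegPush_tmul_single, neg_affine, neg_affine]
  simp only [Matrix.neg_cons, Matrix.neg_empty, neg_add]
  abel

theorem sTheta_prism [Finite E] {n : G.N} {x y w : G.NReal} {t : ℝ}
    (h : y - x = t • G.incl ℝ n) : G.sTheta l (G.prism l n x y w) = 0 := by
  have hy : y = x + t • G.incl ℝ n := (sub_eq_iff_eq_add'.1 h)
  rw [prism, TensorProduct.tmul_sub, map_sub, sTheta_tmul_single, sTheta_tmul_single,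
    sThetaSimplex_affine, sThetaSimplex_affine, hy]
  change wedgeBilin _ (x + t • G.incl ℝ n - x) (x + t • G.incl ℝ n + w - x) -
    wedgeBilin _ (x + w - x) (x + t • G.incl ℝ n + w - x) = 0
  have hw := (isAlt_wedgeBilin (A := ℝ) (G.incl ℝ n)).neg w (G.incl ℝ n)
  rw [wedgeBilin_self, neg_eq_zero] at hw
  rw [add_assoc, add_sub_cancel_left, add_sub_cancel_left, add_sub_cancel_left, map_smul,
    LinearMap.smul_apply, wedgeBilin_self, map_add, map_smul, hw,
    (isAlt_wedgeBilin (A := ℝ) (G.incl ℝ n)).self_eq_zero w, smul_zero, add_zero, sub_zero]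

/-- The chain swept out by the Abel–Jacobi image of the curve as the base point moves from `a` to
`p`. -/
def basePointHomotopy [Fintype E] (a : V) (p : G.CurvePoint l) : G.STChain l 2 :=
  ∑ e, G.prism l (G.edgeClass e) (G.projC l (G.path a (G.tail e)))
    (G.projC l (G.path a (G.tail e)) + G.projC l (Finsupp.single e 1)) (G.abelJacobiLift l p a)

section Connected

variable {G} (hG : G.Connected)
include hG

theorem Connected.affine_path_add_single (a : V) (e : E) (w : G.NReal) :
    SmoothSimplex.affine l ![G.projC l (G.path a (G.tail e)) + G.projC l (Finsupp.single e 1),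
        G.projC l (G.path a (G.tail e)) + G.projC l (Finsupp.single e 1) + w] =
      SmoothSimplex.affine l ![G.projC l (G.path a (G.head e)),
        G.projC l (G.path a (G.head e)) + w] := by
  have hc : G.boundary₁ (G.path a (G.tail e) + Finsupp.single e 1 - G.path a (G.head e)) = 0 := by
    simp [hG.boundary₁_path, boundary₁_single]
  refine G.affine_eq_of_eq_add_projC l hc ?_ ?_
  all_goals
    simp only [map_add, map_sub]
    abel

theorem Connected.sAbelJacobiEdge_eq (a : V) (p : G.CurvePoint l) (e : E) :
    G.sAbelJacobiEdge l p e = G.edgeClass e ⊗ₜ Finsupp.single (SmoothSimplex.affine l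
      ![G.projC l (G.path a (G.tail e)) + G.abelJacobiLift l p a,
        G.projC l (G.path a (G.tail e)) + G.projC l (Finsupp.single e 1)
          + G.abelJacobiLift l p a]) 1 := by
  have hc : G.boundary₁ (G.path a (G.tail e) + G.path p.root a - G.path p.root (G.tail e)) = 0 := by
    simp [hG.boundary₁_path]
  rw [sAbelJacobiEdge]
  refine congrArg (fun s => _ ⊗ₜ Finsupp.single s 1)
    (G.affine_eq_of_eq_add_projC l hc ?_ ?_).symm
  all_goals
    simp only [abelJacobiLift, map_add, map_sub]
    abel

theorem Connected.stBoundary_basePointHomotopy [Fintype E] (a : V) (p : G.CurvePoint l) :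
    G.stBoundary l 1 (G.basePointHomotopy l a p) =
      ∑ e, G.sAbelJacobiEdge l (CurvePoint.vertex a) e - ∑ e, G.sAbelJacobiEdge l p e := by
  have hv (e : E) : G.sAbelJacobiEdge l (CurvePoint.vertex a) e =
      G.edgeClass e ⊗ₜ Finsupp.single (SmoothSimplex.affine l ![G.projC l (G.path a (G.tail e)),
        G.projC l (G.path a (G.tail e)) + G.projC l (Finsupp.single e 1)]) 1 := by
    simp [sAbelJacobiEdge, abelJacobiLift, CurvePoint.offset, CurvePoint.root]
  rw [basePointHomotopy, map_sum]
  simp only [stBoundary_prism, hG.affine_path_add_single, Finset.sum_add_distrib, ← hv,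
    ← hG.sAbelJacobiEdge_eq l a p, Finset.sum_sub_distrib]
  rw [G.sum_edgeClass_tmul fun b => (Finsupp.single (SmoothSimplex.affine l
    ![G.projC l (G.path a b), G.projC l (G.path a b) + G.abelJacobiLift l p a]) 1 : G.SChain l 1),
    zero_add]

end Connected

theorem sTheta_basePointHomotopy [Fintype E] (a : V) (p : G.CurvePoint l) :
    G.sTheta l (G.basePointHomotopy l a p) = 0 := by
  rw [basePointHomotopy, map_sum]
  refine Finset.sum_eq_zero fun e _ => G.sTheta_prism l (t := l.1 e) ?_
  rw [smul_incl_edgeClass, add_sub_cancel_left]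

theorem sTheta_sNegPush_basePointHomotopy [Fintype E] (a : V) (p : G.CurvePoint l) :
    G.sTheta l (G.sNegPush l 2 (G.basePointHomotopy l a p)) = 0 := by
  rw [basePointHomotopy, map_sum, map_sum]
  refine Finset.sum_eq_zero fun e _ => ?_
  rw [sNegPush_prism, map_neg, neg_eq_zero]
  refine G.sTheta_prism l (t := -l.1 e) ?_
  rw [neg_smul, smul_incl_edgeClass]
  abel

variable {G} in
theorem Connected.exists_stBoundary_eq_tropicalCeresaCycle [Fintype E] (hG : G.Connected) (a : V)
    (p : G.CurvePoint l) {S : G.STChain l 2}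
    (hS : G.stBoundary l 1 S = G.tropicalCeresaCycle l (CurvePoint.vertex a)) :
    ∃ S', G.stBoundary l 1 S' = G.tropicalCeresaCycle l p ∧ G.sTheta l S' = G.sTheta l S := by
  set P := G.basePointHomotopy l a p
  refine ⟨S - (P - G.sNegPush l 2 P), ?_, ?_⟩
  · rw [map_sub, map_sub, stBoundary_sNegPush, hG.stBoundary_basePointHomotopy, hS,
      tropicalCeresaCycle, tropicalCeresaCycle, map_sub]
    abel
  · rw [map_sub, map_sub, sTheta_basePointHomotopy, sTheta_sNegPush_basePointHomotopy, sub_zero,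
      sub_zero]

end BasePoint

/-! ### The vanishing locus of the Ceresa period -/

section Vanishing

theorem totalDegree_map_ne_zero_of_aeval_eq_zero {σ K : Type*} [CommRing K] [CharZero K]
    {f : MvPolynomial σ ℤ} (hf : f ≠ 0) {x : σ → K} (hx : MvPolynomial.aeval x f = 0) :
    (MvPolynomial.map (Int.castRingHom K) f).totalDegree ≠ 0 := by
  intro h
  have hC := MvPolynomial.totalDegree_eq_zero_iff_eq_C.1 h
  have hx' : MvPolynomial.eval x (MvPolynomial.map (Int.castRingHom K) f) = 0 := by
    rwa [MvPolynomial.eval_map]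
  rw [hC, MvPolynomial.eval_C] at hx'
  rw [hx', map_zero] at hC
  exact hf (MvPolynomial.map_injective _ Int.cast_injective (by rw [hC, map_zero]))

variable {G} in
theorem veryGeneral_of_polynomials {ι : Type*} [Countable ι] {P : G.Length → Prop}
    (f : ι → MvPolynomial E ℤ) (hf : ∀ i, f i ≠ 0)
    (h : ∀ l : G.Length, ¬ P l → ∃ i, MvPolynomial.aeval l.1 (f i) = 0) : G.VeryGeneral P := by
  set fReal : ι → MvPolynomial E ℝ := fun i => MvPolynomial.map (Int.castRingHom ℝ) (f i)
  set Z : ι → Set G.Moduli := fun i => G.toModuli '' {l | MvPolynomial.eval l.1 (fReal i) = 0}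
  refine ⟨Z '' {i | (fReal i).totalDegree ≠ 0}, (Set.to_countable _).image Z, ?_, fun l hl => ?_⟩
  · rintro _ ⟨i, hi, rfl⟩
    exact ⟨fReal i, hi, rfl⟩
  · by_contra hP
    obtain ⟨i, hi⟩ := h l hP
    refine hl ⟨Z i, ⟨i, totalDegree_map_ne_zero_of_aeval_eq_zero (hf i) hi, rfl⟩, l, ?_, rfl⟩
    exact (MvPolynomial.eval_map _ _ _).trans hi

variable [Finite E]

open Classical in
/-- The finite set of coordinates of a trivector over `G.R = ℤ[x_e]` in the basis of the exterior
cube given by a basis of `N`. -/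
def wedgeCoordinates (w : G.WedgeR) : Finset (MvPolynomial E ℤ) :=
  Finset.univ.image (((G.basisNExt G.R).exteriorPower 3).repr w)

variable {G l} in
theorem mapWedge_evalLength_eq_zero_iff {w : G.WedgeR} :
    G.mapWedge (G.evalLength l) w = 0 ↔
      ∀ f ∈ G.wedgeCoordinates w, MvPolynomial.aeval l.1 f = 0 := by
  rw [mapExteriorPower_eq_zero_iff, wedgeCoordinates]
  simp only [Finset.mem_image, Finset.mem_univ, true_and, forall_exists_index,
    forall_apply_eq_imp_iff]
  rfl

theorem exists_mem_wedgeCoordinates_ne_zero {w : G.WedgeR} (hw : w ≠ 0) :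
    ∃ f ∈ G.wedgeCoordinates w, f ≠ 0 := by
  classical
  contrapose! hw
  exact ((G.basisNExt G.R).exteriorPower 3).ext_elem fun s => by
    rw [map_zero, hw _ (Finset.mem_image_of_mem _ (Finset.mem_univ s)), Finsupp.zero_apply]

instance : Countable G.WedgeR := by
  have : Countable G.R := (MvPolynomial.basisMonomials E ℤ).repr.injective.countable
  exact ((G.basisNExt G.R).exteriorPower 3).repr.injective.countable

end Vanishing

section VanishingPolynomials

variable {G} [Fintype E]

variable {l} in
theorem tropicalCeresaPeriod_eq_mk {p : G.CurvePoint l} {S : G.STChain l 2}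
    (hS : G.stBoundary l 1 S = G.tropicalCeresaCycle l p) :
    G.tropicalCeresaPeriod l p = QuotientAddGroup.mk (G.sTheta l S) := by
  have h : ∃ S, G.stBoundary l 1 S = G.tropicalCeresaCycle l p := ⟨S, hS⟩
  rw [tropicalCeresaPeriod, dif_pos h, QuotientAddGroup.eq]
  refine ⟨-h.choose + S, ?_, by rw [map_add, map_neg]⟩
  rw [SetLike.mem_coe, LinearMap.mem_ker, map_add, map_neg, h.choose_spec, hS, neg_add_cancel]

theorem exists_theta_notMem_periods {a : V} (hα : G.ceresaPeriod a ≠ 0) :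
    ∃ S, G.tBoundary 1 S = G.ceresaCycle a ∧ G.theta S ∉ G.periods := by
  rw [ceresaPeriod] at hα
  split_ifs at hα with h
  · exact ⟨h.choose, h.choose_spec, fun h' => hα ((QuotientAddGroup.eq_zero_iff _).2 h')⟩
  · exact absurd rfl hα

theorem Connected.tropicalCeresaPeriod_eq_zero_iff (hG : G.Connected) {a : V} {S : G.TChain 2}
    (hS : G.tBoundary 1 S = G.ceresaCycle a) (p : G.CurvePoint l) :
    G.tropicalCeresaPeriod l p = 0 ↔ ∃ w : G.periods,
      ∀ f ∈ G.wedgeCoordinates (G.theta S - w.1), MvPolynomial.aeval l.1 f = 0 := by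
  obtain ⟨S', hS', hθ⟩ := hG.exists_stBoundary_eq_tropicalCeresaCycle l a p
    (S := G.specialize l 2 S) (by rw [stBoundary_specialize, hS, specialize_ceresaCycle])
  simp only [tropicalCeresaPeriod_eq_mk hS', QuotientAddGroup.eq_zero_iff, hθ, sTheta_specialize,
    mem_tropicalPeriods_iff, ← mapWedge_evalLength_eq_zero_iff, map_sub, sub_eq_zero,
    eq_comm (a := G.mapWedge _ (G.theta S)), Subtype.exists, exists_prop]

theorem Connected.exists_vanishing_polynomials (hG : G.Connected) {a : V}
    (hα : G.ceresaPeriod a ≠ 0) :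
    ∃ F : ℕ → Finset (MvPolynomial E ℤ), (∀ n, ∃ f ∈ F n, f ≠ 0) ∧
      ∀ (l : G.Length) (p : G.CurvePoint l),
        G.tropicalCeresaPeriod l p = 0 ↔ ∃ n, ∀ f ∈ F n, MvPolynomial.aeval l.1 f = 0 := by
  obtain ⟨S, hS, hθ⟩ := exists_theta_notMem_periods hα
  obtain ⟨w, hw⟩ := exists_surjective_nat G.periods
  refine ⟨fun n => G.wedgeCoordinates (G.theta S - (w n).1), fun n => ?_, fun l p => ?_⟩
  · exact G.exists_mem_wedgeCoordinates_ne_zero (sub_ne_zero.2 fun h => hθ (h ▸ (w n).2))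
  · rw [hG.tropicalCeresaPeriod_eq_zero_iff l hS]
    exact hw.exists

end VanishingPolynomials

end Multigraph

end CeresaPeriod

end

theorem mainTheorem5 {V : Type*} {E : Type*} [Fintype V] [Fintype E]
    (G : CeresaPeriod.Multigraph V E) (hG : G.Connected)
    (a : V) (hα : G.ceresaPeriod a ≠ 0) :
    G.VeryGeneral (fun l => ∀ p : G.CurvePoint l, G.tropicalCeresaPeriod l p ≠ 0) ∧
    ∃ F : ℕ → Finset (MvPolynomial E ℤ), (∀ n, ∃ f ∈ F n, f ≠ 0) ∧
      ∀ (l : G.Length) (p : G.CurvePoint l),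
        G.tropicalCeresaPeriod l p = 0 ↔ ∃ n, ∀ f ∈ F n, MvPolynomial.aeval l.1 f = 0 := by
  obtain ⟨F, hF, h⟩ := hG.exists_vanishing_polynomials hα
  refine ⟨?_, F, hF, h⟩
  choose f hf hf0 using hF
  refine CeresaPeriod.Multigraph.veryGeneral_of_polynomials f hf0 fun l hl => ?_
  push Not at hl
  obtain ⟨p, hp⟩ := hl
  obtain ⟨n, hn⟩ := (h l p).1 hp
  exact ⟨n, hn _ (hf n)⟩
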